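/- Let $q$ and $p$ be nonzero complex parameters (for real $q$, $p$ all polynomials below are real). For a polynomial system $\dot z=P(z,y)$, $\dot y=Q(z,y)$, a polynomial $g$ defines an invariant algebraic curve $g=0$ with cofactor $K$ if $P\,\partial g/\partial z+Q\,\partial g/\partial y=Kg$ in $\mathbb C[z,y]$. The genus of an irreducible plane curve $g=0$ is the genus of its smooth projective model over $\mathbb C$, i.e. the dimension of the space of everywhere regular differentials of its function field. In each of the following two cases the polynomial $g$ is irreducible over $\mathbb C$ and has (total) degree fifteen, and the curve $g=0$ is an invariant algebraic curve of the given quadratic system with cofactor $K=15y$ and has genus two. (i) The system $\dot z=zy+1,\quad \dot y=3y^2-\frac{6}{17}qzy-\frac{8}{289}q^2z^2+q$, with $$\begin{aligned} g={}&y^5-\tfrac{135}{1156}q^3z+\tfrac{204600}{410338673}q^7z^9-\tfrac{49546}{1419857}q^5z^5-\tfrac{31800}{24137569}q^6z^7-\tfrac{365760}{6975757441}q^8z^{11}\\ &-\tfrac{36864}{2015993900449}q^{10}z^{15}+\tfrac{11915}{250563}q^4z^3-\tfrac{300}{289}q^2z^3y^4-\tfrac{15}{17}qzy^4-\tfrac{69120}{6975757441}q^8yz^{12}\\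 &+\tfrac{14250}{83521}q^4yz^4-\tfrac{99000}{24137569}q^6yz^8-\tfrac{685}{4913}q^3yz^2+\tfrac{19800}{1419857}q^5yz^6+\tfrac{190080}{410338673}q^7yz^{10}\\ &-\tfrac{15780}{83521}q^4y^2z^5+\tfrac{11880}{1419857}q^5y^2z^7-\tfrac{190}{289}q^2y^2z-\tfrac{485}{4913}q^3y^2z^3-\tfrac{31680}{24137569}q^6y^2z^9\\ &-\tfrac{145}{289}q^2y^3z^2+\tfrac{3600}{4913}q^3y^3z^4-\tfrac{1320}{83521}q^4y^3z^6+\tfrac{207360}{118587876497}q^9z^{13}+\tfrac{135}{1156}q^2y+\tfrac{35}{51}qy^3 . \end{aligned}$$ (ii) The system $\dot z=zy+1,\quad \dot y=3y^2-\frac{4}{3}pzy-\frac{16}{3}p^2z^2+p$, with $$\begin{aligned} g={}&y^5+\tfrac{2621440}{19683}p^8yz^{12}+\tfrac{2560000}{19683}p^6yz^8-\tfrac{313600}{6561}p^5yz^6-\tfrac{3768320}{19683}p^7yz^{10}+\tfrac{1300}{81}p^2y^4z^3\\ &-\tfrac{10}{3}py^4z+\tfrac{265}{27}p^2y^3z^2-\tfrac{10400}{243}p^3y^3z^4+\tfrac{474880}{6561}p^4y^3z^6+\tfrac{143840}{2187}p^4y^2z^5-\tfrac{949760}{6561}p^5y^2z^7\\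 &+\tfrac{35}{54}p^2y^2z-\tfrac{9130}{729}p^3y^2z^3+\tfrac{942080}{6561}p^6y^2z^9-\tfrac{695}{486}p^3yz^2+\tfrac{7000}{729}p^4yz^4+\tfrac{5}{18}py^3\\ &+\tfrac{8388608}{177147}p^{10}z^{15}-\tfrac{10}{81}p^3z+\tfrac{1015}{1458}p^4z^3-\tfrac{2512}{729}p^5z^5+\tfrac{10}{81}p^2y+\tfrac{92800}{6561}p^6z^7\\ &-\tfrac{7577600}{177147}p^7z^9+\tfrac{4751360}{59049}p^8z^{11}-\tfrac{5242880}{59049}p^9z^{13} . \end{aligned}$$ -/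

import Mathlib

open MvPolynomial

noncomputable section

namespace QuadraticCurves

/-- Polynomials in two variables over the complex numbers. -/
abbrev Poly : Type := MvPolynomial (Fin 2) ℂ

/-- The coordinate `z`. -/
def z : Poly := X 0

/-- The coordinate `y`. -/
def y : Poly := X 1

/-- `g = 0` is an invariant algebraic curve, with cofactor `K`, of the polynomial system
`dz/dt = P`, `dy/dt = Q`: the derivative of `g` along the vector field is `K * g`. -/
def IsInvariantWithCofactor (P Q g K : Poly) : Prop :=
  P * pderiv 0 g + Q * pderiv 1 g = K * g

/-! ### Genus of an irreducible plane curve -/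

/-- For a valuation ring `O` of `F` that contains `k`, the differentials of `F` over `k` that are
regular at `O`: the image of `Ω[O⁄k]` in `Ω[F⁄k]`, that is, the finite sums of differentials
`a db` with `a` and `b` in `O`. -/
def regularDifferentialsAt (k F : Type*) [Field k] [Field F] [Algebra k F]
    (O : ValuationSubring F) : Submodule k (Ω[F⁄k]) :=
  Submodule.span k {ω | ∃ a ∈ O, ∃ b ∈ O, ω = a • KaehlerDifferential.D k F b}

/-- The differentials of `F` over `k` that are regular at every valuation ring of `F` containing
`k`. When `F` is a function field in one variable over an algebraically closed field `k`, these
rings (other than `F` itself) are the local rings at the closed points of the smooth projective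
curve with function field `F`, so these are the global regular differentials of that curve. -/
def regularDifferentials (k F : Type*) [Field k] [Field F] [Algebra k F] :
    Submodule k (Ω[F⁄k]) :=
  ⨅ (O : ValuationSubring F) (_ : ∀ c : k, algebraMap k F c ∈ O), regularDifferentialsAt k F O

/-- The genus of a function field in one variable: the dimension of its space of everywhere
regular differentials. -/
def functionFieldGenus (k F : Type*) [Field k] [Field F] [Algebra k F] : ℕ :=
  Module.finrank k (regularDifferentials k F)

/-- The coordinate ring of the affine plane curve `g = 0`. -/
abbrev CoordinateRing (g : Poly) : Type := Poly ⧸ Ideal.span {g}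

theorem isDomain_coordinateRing {g : Poly} (hg : Irreducible g) : IsDomain (CoordinateRing g) := by
  have : (Ideal.span {g}).IsPrime := (Ideal.span_singleton_prime hg.ne_zero).2 hg.prime
  exact Ideal.Quotient.isDomain _

/-- The (geometric) genus of the irreducible plane curve `g = 0`: the genus of its function field,
equivalently of the smooth projective model of the curve. -/
def curveGenus (g : Poly) (hg : Irreducible g) : ℕ :=
  haveI := isDomain_coordinateRing hg
  functionFieldGenus ℂ (FractionRing (CoordinateRing g))

/-! ### The two systems and their curves -/

/-- Right-hand side of `dz/dt` in both systems. -/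
def P : Poly := z * y + 1

/-- Right-hand side of `dy/dt` in the first system. -/
def Q₁ (q : ℂ) : Poly :=
  3 * y ^ 2 - C (6 / 17 * q) * z * y - C (8 / 289 * q ^ 2) * z ^ 2 + C q

/-- Right-hand side of `dy/dt` in the second system. -/
def Q₂ (p : ℂ) : Poly :=
  3 * y ^ 2 - C (4 / 3 * p) * z * y - C (16 / 3 * p ^ 2) * z ^ 2 + C p

/-- The curve of degree fifteen of the first system. -/
def g₁ (q : ℂ) : Poly :=
  y ^ 5 - C (135 / 1156 * q ^ 3) * z + C (204600 / 410338673 * q ^ 7) * z ^ 9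
    - C (49546 / 1419857 * q ^ 5) * z ^ 5 - C (31800 / 24137569 * q ^ 6) * z ^ 7
    - C (365760 / 6975757441 * q ^ 8) * z ^ 11 - C (36864 / 2015993900449 * q ^ 10) * z ^ 15
    + C (11915 / 250563 * q ^ 4) * z ^ 3 - C (300 / 289 * q ^ 2) * z ^ 3 * y ^ 4
    - C (15 / 17 * q) * z * y ^ 4 - C (69120 / 6975757441 * q ^ 8) * y * z ^ 12
    + C (14250 / 83521 * q ^ 4) * y * z ^ 4 - C (99000 / 24137569 * q ^ 6) * y * z ^ 8
    - C (685 / 4913 * q ^ 3) * y * z ^ 2 + C (19800 / 1419857 * q ^ 5) * y * z ^ 6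
    + C (190080 / 410338673 * q ^ 7) * y * z ^ 10 - C (15780 / 83521 * q ^ 4) * y ^ 2 * z ^ 5
    + C (11880 / 1419857 * q ^ 5) * y ^ 2 * z ^ 7 - C (190 / 289 * q ^ 2) * y ^ 2 * z
    - C (485 / 4913 * q ^ 3) * y ^ 2 * z ^ 3 - C (31680 / 24137569 * q ^ 6) * y ^ 2 * z ^ 9
    - C (145 / 289 * q ^ 2) * y ^ 3 * z ^ 2 + C (3600 / 4913 * q ^ 3) * y ^ 3 * z ^ 4
    - C (1320 / 83521 * q ^ 4) * y ^ 3 * z ^ 6 + C (207360 / 118587876497 * q ^ 9) * z ^ 13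
    + C (135 / 1156 * q ^ 2) * y + C (35 / 51 * q) * y ^ 3

/-- The curve of degree fifteen of the second system. -/
def g₂ (p : ℂ) : Poly :=
  y ^ 5 + C (2621440 / 19683 * p ^ 8) * y * z ^ 12 + C (2560000 / 19683 * p ^ 6) * y * z ^ 8
    - C (313600 / 6561 * p ^ 5) * y * z ^ 6 - C (3768320 / 19683 * p ^ 7) * y * z ^ 10
    + C (1300 / 81 * p ^ 2) * y ^ 4 * z ^ 3 - C (10 / 3 * p) * y ^ 4 * z
    + C (265 / 27 * p ^ 2) * y ^ 3 * z ^ 2 - C (10400 / 243 * p ^ 3) * y ^ 3 * z ^ 4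
    + C (474880 / 6561 * p ^ 4) * y ^ 3 * z ^ 6 + C (143840 / 2187 * p ^ 4) * y ^ 2 * z ^ 5
    - C (949760 / 6561 * p ^ 5) * y ^ 2 * z ^ 7 + C (35 / 54 * p ^ 2) * y ^ 2 * z
    - C (9130 / 729 * p ^ 3) * y ^ 2 * z ^ 3 + C (942080 / 6561 * p ^ 6) * y ^ 2 * z ^ 9
    - C (695 / 486 * p ^ 3) * y * z ^ 2 + C (7000 / 729 * p ^ 4) * y * z ^ 4
    + C (5 / 18 * p) * y ^ 3 + C (8388608 / 177147 * p ^ 10) * z ^ 15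
    - C (10 / 81 * p ^ 3) * z + C (1015 / 1458 * p ^ 4) * z ^ 3
    - C (2512 / 729 * p ^ 5) * z ^ 5 + C (10 / 81 * p ^ 2) * y
    + C (92800 / 6561 * p ^ 6) * z ^ 7 - C (7577600 / 177147 * p ^ 7) * z ^ 9
    + C (4751360 / 59049 * p ^ 8) * z ^ 11 - C (5242880 / 59049 * p ^ 9) * z ^ 13

end QuadraticCurves

end

/-! Both curves are birational to explicit genus-two curves `w ^ 2 = f(x)`. Giving `z`, `y` and the
parameter the weights -1, 1 and 2 makes `g` quasi-homogeneous of weight 5, so a linear change of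
coordinates reduces everything to `q = 17` and `p = 3`. There `z = w n(x) / r(x)`, `y = w t(x) /
r(x) ^ 2` with `w ^ 2 = c x r(x)`, `deg r = 5`, satisfies `g = 0` by an identity in `x` alone. The
map is inverted by `x = N(z, y) / D(z, y)` and `w = z r(x) / n(x)`.

Irreducibility: `g` is monic of degree five in `y`. A monic factor that vanishes on the parametrised
curve vanishes at the five distinct points with `z = 0` reached by the parametrisation, so it
already has degree five (`irreducible_of_specialization`). As `ℂ[z, y] / (g)` is finite over `ℂ[z]`,
the polynomials killed by the parametrisation are exactly the multiples of `g`
(`dvd_of_map_eq_zero`), and the function field of `g = 0` is `ℂ(x, w)`.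

Genus (`IsHyperellipticModel.functionFieldGenus_eq_two`): since `f` is squarefree, the integral
closure of `ℂ[x]` is `ℂ[x] + ℂ[x] w`, and the differentials regular on this affine chart are its
multiples of `dx / w`. The same holds in the chart `u = 1 / x`, `v = w / x ^ 3`; only the
combinations of `dx / w` and `x dx / w` are regular in both.

Invariance is a polynomial identity, and the degree is read off from the monomials, with `z ^ 15`
attaining it. -/

namespace QuadraticCurves

open scoped Polynomial

/-! ### Divisibility by squares. -/

section Polynomials

variable {k : Type*} [Field k]

/-- After cancelling the gcd of `b` and `c`, the square of the remaining factor of `c` divides the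
squarefree `f`, so that factor is a unit. -/
theorem dvd_of_sq_dvd_sq_mul {f b c : k[X]} (hf : Squarefree f) (hc : c ≠ 0)
    (h : c ^ 2 ∣ b ^ 2 * f) : c ∣ b := by
  classical
  obtain ⟨d, hd⟩ : ∃ d, d = EuclideanDomain.gcd b c := ⟨_, rfl⟩
  have hd0 : d ≠ 0 := by
    rintro rfl
    exact hc (EuclideanDomain.gcd_eq_zero_iff.1 hd.symm).2
  obtain ⟨b', hb'⟩ := hd ▸ EuclideanDomain.gcd_dvd_left b c
  obtain ⟨c', hc'⟩ := hd ▸ EuclideanDomain.gcd_dvd_right b c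
  have hcop : IsCoprime b' c' := by
    refine ⟨EuclideanDomain.gcdA b c, EuclideanDomain.gcdB b c, mul_left_cancel₀ hd0 ?_⟩
    have e := EuclideanDomain.gcd_eq_gcd_ab b c
    rw [← hd] at e
    rw [mul_one]
    conv_rhs => rw [e]
    linear_combination (-EuclideanDomain.gcdA b c) * hb' - EuclideanDomain.gcdB b c * hc'
  have h1 : c' ^ 2 ∣ b' ^ 2 * f := by
    rw [hb', hc'] at h
    have : d ^ 2 * c' ^ 2 ∣ d ^ 2 * (b' ^ 2 * f) := by convert h using 1 <;> ring
    exact (mul_dvd_mul_iff_left (pow_ne_zero 2 hd0)).1 this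
  have h2 : c' ^ 2 ∣ f := (hcop.symm.pow (m := 2) (n := 2)).dvd_of_dvd_mul_left h1
  have h3 : IsUnit c' := hf c' (by rwa [← sq])
  rw [hb', hc']
  exact mul_dvd_mul_left d (h3.dvd)

end Polynomials

/-! ### Hyperelliptic function fields. -/

/-- `F = k(x, w)` with `x` transcendental and `w ^ 2 = f(x)`, where `f` is separable and not a
square up to squares. -/
structure IsHyperellipticModel {k F : Type*} [Field k] [Field F] [Algebra k F] (x w : F)
    (f : k[X]) : Prop where
  transcendental : Transcendental k x
  sq_eq : w ^ 2 = Polynomial.aeval x f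
  separable : f.Separable
  eq_zero_of_sq_eq : ∀ a b : k[X], a ^ 2 = b ^ 2 * f → b = 0
  adjoin_eq_top : IntermediateField.adjoin k {x, w} = ⊤

namespace IsHyperellipticModel

variable {k F : Type*} [Field k] [Field F] [Algebra k F] {x w : F} {f : k[X]}

theorem aeval_eq_zero (h : IsHyperellipticModel x w f) {a : k[X]}
    (ha : Polynomial.aeval x a = 0) : a = 0 :=
  (transcendental_iff.1 h.transcendental) a ha

theorem eq_zero_of_add_mul_eq_zero (h : IsHyperellipticModel x w f) {a b : k[X]}
    (hab : Polynomial.aeval x a + Polynomial.aeval x b * w = 0) : a = 0 ∧ b = 0 := by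
  have hb : b = 0 := by
    refine h.eq_zero_of_sq_eq a b (sub_eq_zero.1 (h.aeval_eq_zero ?_))
    have := h.sq_eq
    simp only [map_sub, map_pow, map_mul]
    linear_combination (Polynomial.aeval x a - Polynomial.aeval x b * w) * hab
      + (Polynomial.aeval x b) ^ 2 * this
  subst hb
  exact ⟨h.aeval_eq_zero (by simpa using hab), rfl⟩

theorem norm_ne_zero (h : IsHyperellipticModel x w f) {a b : k[X]}
    (hab : Polynomial.aeval x a + Polynomial.aeval x b * w ≠ 0) : a ^ 2 - b ^ 2 * f ≠ 0 := by
  intro h0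
  have hb := h.eq_zero_of_sq_eq a b (sub_eq_zero.1 h0)
  subst hb
  have ha : a = 0 := by simpa using h0
  subst ha
  simp at hab

/-- This is `F = k(x) + k(x) w` with denominators cleared. Inverses come from the conjugate `a - b
w`, because `(a + b w)(a - b w) = a ^ 2 - b ^ 2 f` is nonzero by `norm_ne_zero`. -/
theorem exists_mul_eq (h : IsHyperellipticModel x w f) (s : F) :
    ∃ a b c : k[X], c ≠ 0 ∧
      s * Polynomial.aeval x c = Polynomial.aeval x a + Polynomial.aeval x b * w := by
  have hs : s ∈ IntermediateField.adjoin k {x, w} := by rw [h.adjoin_eq_top]; trivial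
  induction hs using IntermediateField.adjoin_induction with
  | mem y hy =>
    rcases hy with rfl | rfl
    · exact ⟨Polynomial.X, 0, 1, one_ne_zero, by simp⟩
    · exact ⟨0, 1, 1, one_ne_zero, by simp⟩
  | algebraMap r => exact ⟨Polynomial.C r, 0, 1, one_ne_zero, by simp⟩
  | add s t _ _ hs ht =>
    obtain ⟨a, b, c, hc, e⟩ := hs
    obtain ⟨a', b', c', hc', e'⟩ := ht
    refine ⟨a * c' + a' * c, b * c' + b' * c, c * c', mul_ne_zero hc hc', ?_⟩
    simp only [map_add, map_mul]
    linear_combination Polynomial.aeval x c' * e + Polynomial.aeval x c * e'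
  | mul s t _ _ hs ht =>
    obtain ⟨a, b, c, hc, e⟩ := hs
    obtain ⟨a', b', c', hc', e'⟩ := ht
    refine ⟨a * a' + b * b' * f, a * b' + a' * b, c * c', mul_ne_zero hc hc', ?_⟩
    simp only [map_add, map_mul]
    linear_combination t * Polynomial.aeval x c' * e
      + (Polynomial.aeval x a + Polynomial.aeval x b * w) * e'
      + Polynomial.aeval x b * Polynomial.aeval x b' * h.sq_eq
  | inv s _ hs =>
    obtain ⟨a, b, c, hc, e⟩ := hs
    by_cases hs0 : s = 0
    · exact ⟨0, 0, 1, one_ne_zero, by simp [hs0]⟩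
    have hc' : Polynomial.aeval x c ≠ 0 := fun h0 => hc (h.aeval_eq_zero h0)
    have hn := h.norm_ne_zero (e ▸ mul_ne_zero hs0 hc')
    refine ⟨a * c, -(b * c), a ^ 2 - b ^ 2 * f, hn, ?_⟩
    have key : Polynomial.aeval x (a ^ 2 - b ^ 2 * f)
        = s * (Polynomial.aeval x (a * c) + Polynomial.aeval x (-(b * c)) * w) := by
      simp only [map_sub, map_neg, map_mul, map_pow]
      linear_combination (-(Polynomial.aeval x a - Polynomial.aeval x b * w)) * e
        + (Polynomial.aeval x b) ^ 2 * h.sq_eq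
    rw [key, inv_mul_cancel_left₀ hs0]

/-! ### The differential `dx / w` and its regularity where `x` is finite. -/

section Differentials

open KaehlerDifferential

theorem D_aeval (x : F) (a : k[X]) :
    D k F (Polynomial.aeval x a) = Polynomial.aeval x a.derivative • D k F x := by
  rw [Derivation.map_aeval]

theorem ne_zero (h : IsHyperellipticModel x w f) : w ≠ 0 := by
  rintro rfl
  have := (h.eq_zero_of_add_mul_eq_zero (a := 0) (b := 1) (by simp)).2
  exact one_ne_zero this

variable [CharZero k]

theorem D_w (h : IsHyperellipticModel x w f) :
    D k F w = (2⁻¹ * Polynomial.aeval x f.derivative) • (w⁻¹ • D k F x) := by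
  have h2 : (2 : F) ≠ 0 := by
    have := charZero_of_injective_algebraMap (algebraMap k F).injective
    exact two_ne_zero
  have hw := h.ne_zero
  have e : D k F (w ^ 2) = D k F (Polynomial.aeval x f) := by rw [h.sq_eq]
  rw [Derivation.leibniz_pow, D_aeval, pow_one, ← Nat.cast_smul_eq_nsmul F, smul_smul] at e
  rw [smul_smul, mul_right_comm, mul_smul _ _ (D k F x), ← e, smul_smul]
  have : 2⁻¹ * w⁻¹ * (((2 : ℕ) : F) * w) = 1 := by
    push_cast
    field_simp
  rw [this, one_smul]

/-- From `dx = w (dx / w)` and `dw = (f' / 2) (dx / w)`. The absence of denominators is what later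
bounds the regular differentials of the affine chart. -/
theorem D_add_mul (h : IsHyperellipticModel x w f) (a b : k[X]) :
    ∃ c d : k[X], D k F (Polynomial.aeval x a + Polynomial.aeval x b * w) =
      (Polynomial.aeval x c + Polynomial.aeval x d * w) • (w⁻¹ • D k F x) := by
  refine ⟨b.derivative * f + Polynomial.C 2⁻¹ * b * f.derivative, a.derivative, ?_⟩
  have hw := h.ne_zero
  rw [map_add, Derivation.leibniz, D_aeval, D_aeval, h.D_w]
  simp only [smul_smul, ← add_smul]
  congr 1
  simp only [map_add, map_mul, ← h.sq_eq, Polynomial.aeval_C, map_inv₀, map_ofNat]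
  field_simp
  ring

theorem exists_D_eq (h : IsHyperellipticModel x w f) (s : F) :
    ∃ c : F, D k F s = c • (w⁻¹ • D k F x) := by
  obtain ⟨a, b, c, hc, e⟩ := h.exists_mul_eq s
  have hc' : Polynomial.aeval x c ≠ 0 := fun h0 => hc (h.aeval_eq_zero h0)
  obtain ⟨a', b', h'⟩ := h.D_add_mul a b
  have hw := h.ne_zero
  rw [← e, Derivation.leibniz, D_aeval] at h'
  refine ⟨(Polynomial.aeval x c)⁻¹ * (Polynomial.aeval x a' + Polynomial.aeval x b' * w
    - s * Polynomial.aeval x c.derivative * w), ?_⟩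
  have h2 : Polynomial.aeval x c • D k F s = (Polynomial.aeval x a' + Polynomial.aeval x b' * w
    - s * Polynomial.aeval x c.derivative * w) • (w⁻¹ • D k F x) := by
    rw [sub_smul, ← h', mul_smul _ w, smul_smul w, mul_inv_cancel₀ hw, one_smul, mul_smul]
    abel
  rw [mul_smul, ← h2, smul_smul, inv_mul_cancel₀ hc', one_smul]

theorem exists_eq_smul (h : IsHyperellipticModel x w f) (ω : Ω[F⁄k]) :
    ∃ c : F, ω = c • (w⁻¹ • D k F x) := by
  have : ω ∈ Submodule.span F (Set.range (D k F)) := by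
    rw [KaehlerDifferential.span_range_derivation]; trivial
  induction this using Submodule.span_induction with
  | mem y hy => obtain ⟨s, rfl⟩ := hy; exact h.exists_D_eq s
  | zero => exact ⟨0, by simp⟩
  | add s t _ _ hs ht =>
    obtain ⟨c, rfl⟩ := hs
    obtain ⟨d, rfl⟩ := ht
    exact ⟨c + d, by rw [add_smul]⟩
  | smul a s _ hs =>
    obtain ⟨c, rfl⟩ := hs
    exact ⟨a * c, by rw [mul_smul]⟩

/-- As `dx / w` spans all differentials, its vanishing would make `F` unramified over `k`, hence
algebraic, although `x` is transcendental. -/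
theorem inv_smul_D_ne_zero (h : IsHyperellipticModel x w f) : w⁻¹ • D k F x ≠ 0 := by
  intro h0
  have hs : Subsingleton (Ω[F⁄k]) := by
    refine subsingleton_of_forall_eq 0 fun ω => ?_
    obtain ⟨c, rfl⟩ := h.exists_eq_smul ω
    rw [h0, smul_zero]
  have : Algebra.FormallyUnramified k F := ⟨hs⟩
  have : Algebra.EssFiniteType k F := by
    have : (⊤ : IntermediateField k F).FG := by
      rw [← h.adjoin_eq_top]
      classical exact ⟨({x, w} : Finset F), by simp⟩
    exact IntermediateField.fg_top_iff.1 this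
  have := (Algebra.FormallyUnramified.iff_isSeparable k F).1 inferInstance
  exact h.transcendental (Algebra.IsAlgebraic.isAlgebraic x)

/-- If `A f + B f' = 1`, then `dx / w = A w dx + 2 B dw`, because `w ^ 2 = f` and `2 w dw = f' dx`.
This is where separability makes the affine model nonsingular. -/
theorem inv_smul_D_mem (h : IsHyperellipticModel x w f) {O : ValuationSubring F}
    (hk : ∀ c : k, algebraMap k F c ∈ O) (hx : x ∈ O) {s : F} (hs : s ∈ O) :
    s • (w⁻¹ • D k F x) ∈ regularDifferentialsAt k F O := by
  have hp : ∀ a : k[X], Polynomial.aeval x a ∈ O := by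
    intro a
    induction a using Polynomial.induction_on' with
    | add p q hp hq => rw [map_add]; exact O.add_mem _ _ hp hq
    | monomial n c =>
      rw [Polynomial.aeval_monomial]
      exact O.mul_mem _ _ (hk c) (pow_mem hx n)
  have hw0 := h.ne_zero
  have hw : w ∈ O := by
    rcases O.mem_or_inv_mem w with hw | hw
    · exact hw
    · have : w = Polynomial.aeval x f * w⁻¹ := by
        rw [← h.sq_eq]; field_simp
      rw [this]
      exact O.mul_mem _ _ (hp f) hw
  obtain ⟨A, B, hAB⟩ := h.separable
  have key : s • (w⁻¹ • D k F x) = (s * (Polynomial.aeval x A * w)) • D k F x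
      + (s * Polynomial.aeval x (Polynomial.C 2 * B)) • D k F w := by
    rw [h.D_w]
    simp only [smul_smul, ← add_smul]
    congr 1
    have e := congrArg (Polynomial.aeval x) hAB
    simp only [map_add, map_mul, map_one, ← h.sq_eq] at e
    have h2 : (2 : F) ≠ 0 := by
      have := charZero_of_injective_algebraMap (algebraMap k F).injective
      exact two_ne_zero
    simp only [map_mul, map_ofNat]
    field_simp
    linear_combination -s * e
  rw [key]
  exact add_mem (Submodule.subset_span ⟨_, O.mul_mem _ _ hs (O.mul_mem _ _ (hp A) hw), x, hx, rfl⟩)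
    (Submodule.subset_span ⟨_, O.mul_mem _ _ hs (hp _), w, hw, rfl⟩)

end Differentials

end IsHyperellipticModel

/-! ### Regular differentials of the affine chart have integral coefficients. -/

namespace IsHyperellipticModel

variable {k F : Type*} [Field k] [Field F] [Algebra k F] {x w : F} {f : k[X]}

open KaehlerDifferential

/-- Write `s = (a + b w) / c`. Its minimal polynomial over `k[x]` is monic and divides the quadratic
with roots `(a ± b w) / c`; comparing coefficients gives `c ∣ a` and `c ^ 2 ∣ b ^ 2 f`, hence `c ∣
b`. -/
theorem exists_eq_of_isIntegral [CharZero k] [Algebra k[X] F]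
    (hA : ∀ a : k[X], algebraMap k[X] F a = Polynomial.aeval x a) (h : IsHyperellipticModel x w f) {s : F} (hs : IsIntegral k[X] s) :
    ∃ a b : k[X], s = Polynomial.aeval x a + Polynomial.aeval x b * w := by
  obtain ⟨a, b, c, hc, e⟩ := h.exists_mul_eq s
  have hinj : Function.Injective (algebraMap k[X] F) := by
    refine (injective_iff_map_eq_zero _).2 fun p hp => h.aeval_eq_zero ?_
    rw [← hA, hp]
  have : FaithfulSMul k[X] F := (faithfulSMul_iff_algebraMap_injective _ _).2 hinj
  have hc' : Polynomial.aeval x c ≠ 0 := fun h0 => hc (h.aeval_eq_zero h0)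
  let p : k[X][X] := Polynomial.C (c ^ 2) * Polynomial.X ^ 2 + Polynomial.C (-(2 * a * c))
    * Polynomial.X + Polynomial.C (a ^ 2 - b ^ 2 * f)
  have hp : Polynomial.aeval s p = 0 := by
    simp only [p, map_add, map_mul, map_pow, Polynomial.aeval_C, Polynomial.aeval_X, hA,
      map_neg, map_sub, map_ofNat]
    linear_combination (s * Polynomial.aeval x c - Polynomial.aeval x a
      + Polynomial.aeval x b * w) * e + (Polynomial.aeval x b) ^ 2 * h.sq_eq
  have hpd : p.natDegree = 2 := Polynomial.natDegree_quadratic (pow_ne_zero 2 hc)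
  have hp0 : p ≠ 0 := fun h0 => by rw [h0] at hpd; simp at hpd
  obtain ⟨q, hq⟩ := minpoly.isIntegrallyClosed_dvd hs hp
  set m := minpoly k[X] s with hm
  have hmm : m.Monic := minpoly.monic hs
  have hms : Polynomial.aeval s m = 0 := minpoly.aeval _ _
  have hdeg : m.natDegree + q.natDegree = 2 := by
    rw [← hpd, hq, Polynomial.natDegree_mul hmm.ne_zero]
    rintro rfl
    rw [mul_zero] at hq
    exact hp0 hq
  have hpos : 0 < m.natDegree := minpoly.natDegree_pos hs
  obtain h1 | h2 : m.natDegree = 1 ∨ m.natDegree = 2 := by omega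
  · refine ⟨-m.coeff 0, 0, ?_⟩
    rw [hmm.eq_X_add_C h1] at hms
    simp only [map_add, Polynomial.aeval_X, Polynomial.aeval_C, hA] at hms
    simp only [map_neg, map_zero, zero_mul, add_zero]
    linear_combination hms
  -- The cofactor is constant by degree, and the leading coefficient shows that it equals `c ^ 2`.
  · have hq0 : q = Polynomial.C (q.coeff 0) := Polynomial.eq_C_of_natDegree_eq_zero (by omega)
    have hcoef : ∀ n, p.coeff n = m.coeff n * q.coeff 0 := fun n => by
      rw [hq, hq0, Polynomial.coeff_mul_C, Polynomial.coeff_C_zero]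
    have e2 := hcoef 2
    have e1 := hcoef 1
    have e0 := hcoef 0
    have hm2 : m.coeff 2 = 1 := by rw [← h2]; exact hmm
    simp only [p, Polynomial.coeff_add, Polynomial.coeff_C_mul, Polynomial.coeff_X_pow,
      Polynomial.coeff_X, Polynomial.coeff_C, hm2] at e0 e1 e2
    norm_num only [mul_one, mul_zero, add_zero, zero_add, one_mul, if_true, if_false]
      at e0 e1 e2
    rw [← e2] at e0 e1
    have ha : c ∣ a := by
      refine ⟨Polynomial.C (-2⁻¹) * m.coeff 1, ?_⟩
      have h2' : (2 : k[X]) * Polynomial.C (-2⁻¹) = -1 := by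
        rw [← map_ofNat (Polynomial.C) 2, ← map_mul]
        simp
      apply mul_left_cancel₀ (mul_ne_zero (two_ne_zero (α := k[X])) hc)
      linear_combination (-1 : k[X]) * e1 - c ^ 2 * m.coeff 1 * h2'
    obtain ⟨a', rfl⟩ := ha
    have hb : c ∣ b := by
      refine dvd_of_sq_dvd_sq_mul h.separable.squarefree hc ⟨a' ^ 2 - m.coeff 0, ?_⟩
      linear_combination -e0
    obtain ⟨b', rfl⟩ := hb
    refine ⟨a', b', mul_right_cancel₀ hc' ?_⟩
    rw [e]
    simp only [map_mul]
    ring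

theorem finite_fractionRing [Algebra k[X] F] [FaithfulSMul k[X] F]
    [Algebra (FractionRing k[X]) F] [IsScalarTower k[X] (FractionRing k[X]) F]
    (hA : ∀ a : k[X], algebraMap k[X] F a = Polynomial.aeval x a)
    (h : IsHyperellipticModel x w f) : Module.Finite (FractionRing k[X]) F := by
  classical
  refine ⟨⟨{1, w}, ?_⟩⟩
  rw [eq_top_iff]
  rintro s -
  obtain ⟨a, b, c, hc, e⟩ := h.exists_mul_eq s
  have hc' : Polynomial.aeval x c ≠ 0 := fun h0 => hc (h.aeval_eq_zero h0)
  have hK : ∀ a : k[X], algebraMap (FractionRing k[X]) F (algebraMap k[X] _ a) =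
      Polynomial.aeval x a := fun a => by
    rw [← hA, ← IsScalarTower.algebraMap_apply]
  rw [Finset.coe_pair, Submodule.mem_span_pair]
  refine ⟨algebraMap k[X] _ a / algebraMap k[X] _ c, algebraMap k[X] _ b / algebraMap k[X] _ c, ?_⟩
  simp only [Algebra.smul_def, map_div₀, hK]
  field_simp
  linear_combination -e

/-- It suffices that `v(s) ≤ 1` at every height-one prime of the integral closure. An element of the
valuation ring is `n / d` with `n`, `d` integral and `d` a unit at `v`, so the quotient rule and
`D_add_mul` put its differential in `O dx / w`. Thus everything regular at `v` lies in `O dx / w`,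
and `dx / w ≠ 0` lets `s` be read off. -/
theorem exists_eq_of_smul_mem [CharZero k] (h : IsHyperellipticModel x w f) {s : F}
    (hs : s • (w⁻¹ • D k F x) ∈ regularDifferentials k F) :
    ∃ a b : k[X], s = Polynomial.aeval x a + Polynomial.aeval x b * w := by
  let : Algebra k[X] F := (Polynomial.aeval x).toAlgebra
  have hA : ∀ a : k[X], algebraMap k[X] F a = Polynomial.aeval x a := fun _ => rfl
  have hinj : Function.Injective (algebraMap k[X] F) :=
    (injective_iff_map_eq_zero _).2 fun p hp => h.aeval_eq_zero hp
  have : FaithfulSMul k[X] F := (faithfulSMul_iff_algebraMap_injective _ _).2 hinj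
  let : Algebra (FractionRing k[X]) F := FractionRing.liftAlgebra k[X] F
  have := h.finite_fractionRing hA
  have : CharZero (FractionRing k[X]) :=
    charZero_of_injective_algebraMap (IsFractionRing.injective k[X] (FractionRing k[X]))
  have : IsDedekindDomain (integralClosure k[X] F) :=
    integralClosure.isDedekindDomain k[X] (FractionRing k[X]) F
  have : IsFractionRing (integralClosure k[X] F) F :=
    integralClosure.isFractionRing_of_finite_extension (FractionRing k[X]) F
  suffices s ∈ (algebraMap (integralClosure k[X] F) F).range by
    obtain ⟨t, rfl⟩ := this
    exact h.exists_eq_of_isIntegral hA t.2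
  refine IsDedekindDomain.HeightOneSpectrum.mem_integers_of_valuation_le_one
    (R := integralClosure k[X] F) F s fun v => ?_
  have hle : ∀ t : integralClosure k[X] F, v.valuation F (t : F) ≤ 1 := fun t =>
    v.valuation_le_one t
  have hp : ∀ a : k[X], v.valuation F (Polynomial.aeval x a) ≤ 1 := fun a =>
    v.valuation_le_one (algebraMap k[X] (integralClosure k[X] F) a)
  have hk : ∀ c : k, algebraMap k F c ∈ (v.valuation F).valuationSubring := fun c => by
    have := hp (Polynomial.C c)
    rwa [Polynomial.aeval_C] at this
  have hw : v.valuation F w ≤ 1 := by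
    refine hle ⟨w, Polynomial.X ^ 2 - Polynomial.C f, Polynomial.monic_X_pow_sub_C _ two_ne_zero, ?_⟩
    simp [hA, h.sq_eq]
  have hab : ∀ a b : k[X], Polynomial.aeval x a + Polynomial.aeval x b * w ∈
      (v.valuation F).valuationSubring := fun a b =>
    add_mem (hp a) (mul_mem (hp b) hw)
  have hD : ∀ t ∈ (v.valuation F).valuationSubring, ∃ c ∈ (v.valuation F).valuationSubring,
      D k F t = c • (w⁻¹ • D k F x) := by
    intro t ht
    obtain ⟨n, d, e⟩ := IsDedekindDomain.HeightOneSpectrum.exists_primeCompl_mul_eq_of_integer v t ht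
    obtain ⟨n1, n2, hn⟩ := h.exists_eq_of_isIntegral hA n.2
    obtain ⟨d1, d2, hd⟩ := h.exists_eq_of_isIntegral hA d.1.2
    obtain ⟨n3, n4, hn'⟩ := h.D_add_mul n1 n2
    obtain ⟨d3, d4, hd'⟩ := h.D_add_mul d1 d2
    have hdv : v.valuation F (d.1 : F) = 1 :=
      (v.valuation_eq_one_iff_notMem).2 d.2
    have hd0 : (d.1 : F) ≠ 0 := by
      intro h0
      rw [h0, map_zero] at hdv
      exact zero_ne_one hdv
    change t * (d.1 : F) = (n : F) at e
    rw [← hn] at hn'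
    rw [← hd] at hd'
    refine ⟨(d.1 : F)⁻¹ * ((Polynomial.aeval x n3 + Polynomial.aeval x n4 * w)
      - t * (Polynomial.aeval x d3 + Polynomial.aeval x d4 * w)), ?_, ?_⟩
    · refine mul_mem ?_ (sub_mem (hab _ _) (mul_mem ht (hab _ _)))
      change v.valuation F _ ≤ 1
      rw [map_inv₀, hdv, inv_one]
    · rw [← e, Derivation.leibniz, hd'] at hn'
      have : (d.1 : F) • D k F t = ((Polynomial.aeval x n3 + Polynomial.aeval x n4 * w)
          - t * (Polynomial.aeval x d3 + Polynomial.aeval x d4 * w)) • (w⁻¹ • D k F x) := by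
        rw [sub_smul, ← hn', mul_smul]
        abel
      rw [mul_smul, ← this, smul_smul, inv_mul_cancel₀ hd0, one_smul]
  have hreg : s • (w⁻¹ • D k F x) ∈
      regularDifferentialsAt k F (v.valuation F).valuationSubring := by
    have := hs
    simp only [regularDifferentials, Submodule.mem_iInf] at this
    exact this _ hk
  have key : ∀ ω ∈ regularDifferentialsAt k F (v.valuation F).valuationSubring,
      ∃ c ∈ (v.valuation F).valuationSubring, ω = c • (w⁻¹ • D k F x) := by
    intro ω hω
    induction hω using Submodule.span_induction with
    | mem ω hω =>
      obtain ⟨a, ha, b, hb, rfl⟩ := hω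
      obtain ⟨c, hc, e⟩ := hD b hb
      exact ⟨a * c, mul_mem ha hc, by rw [e, mul_smul]⟩
    | zero => exact ⟨0, zero_mem _, by simp⟩
    | add ω η _ _ hω hη =>
      obtain ⟨c, hc, rfl⟩ := hω
      obtain ⟨d, hd, rfl⟩ := hη
      exact ⟨c + d, add_mem hc hd, by rw [add_smul]⟩
    | smul a ω _ hω =>
      obtain ⟨c, hc, rfl⟩ := hω
      exact ⟨algebraMap k F a * c, mul_mem (hk a) hc, by rw [mul_smul, algebraMap_smul]⟩
  obtain ⟨c, hc, e⟩ := key _ hreg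
  have : s = c := smul_left_injective F h.inv_smul_D_ne_zero e
  rw [this]
  exact hc

end IsHyperellipticModel

/-! ### Gluing with the chart at infinity. -/

theorem aeval_reverse_of_mul_eq_one {k F : Type*} [Field k] [Field F] [Algebra k F] {x u : F}
    (hxu : x * u = 1) (p : k[X]) :
    Polynomial.aeval x p.reverse = Polynomial.aeval u p * x ^ p.natDegree := by
  have hu : u ≠ 0 := right_ne_zero_of_mul_eq_one hxu
  let i : Invertible u := ⟨x, hxu, by rw [mul_comm, hxu]⟩
  have := Polynomial.eval₂_reverse_mul_pow (algebraMap k F) u p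
  change Polynomial.aeval x p.reverse * u ^ p.natDegree = Polynomial.aeval u p at this
  rw [← this, mul_assoc, ← mul_pow, mul_comm u, hxu, one_pow, mul_one]

namespace IsHyperellipticModel

variable {k F : Type*} [Field k] [Field F] [Algebra k F] {x w u v : F} {f f' : k[X]}

open KaehlerDifferential

/-- Separating the parts along `1` and `w` gives `a(x) = x a'(1 / x)` and `b(x) = x⁻² b'(1 / x)`.
The right sides have degree at most 1 and -2 in `x`, so `b = 0` and `a` is linear. Reversed
polynomials turn this into degree counts in `k[x]`. -/
theorem exists_linear_of_chart_change (h : IsHyperellipticModel x w f) (hxu : x * u = 1)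
    (hvw : v = w * u ^ 3) {a b a' b' : k[X]}
    (e : u * (Polynomial.aeval x a + Polynomial.aeval x b * w) =
      Polynomial.aeval u a' + Polynomial.aeval u b' * v) :
    ∃ c d : k, Polynomial.aeval x a + Polynomial.aeval x b * w =
      algebraMap k F c + algebraMap k F d * x := by
  have ha := aeval_reverse_of_mul_eq_one hxu a'
  have hb := aeval_reverse_of_mul_eq_one hxu b'
  set m := a'.natDegree
  set n := b'.natDegree
  have hz : Polynomial.aeval x (a * Polynomial.X ^ (m + n + 2)
        - a'.reverse * Polynomial.X ^ (n + 3))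
      + Polynomial.aeval x (b * Polynomial.X ^ (m + n + 2) - b'.reverse * Polynomial.X ^ m) * w
      = 0 := by
    simp only [map_sub, map_mul, map_pow, Polynomial.aeval_X, ha, hb]
    have hu3 : x ^ 3 * u ^ 3 = 1 := by rw [← mul_pow, hxu, one_pow]
    rw [hvw] at e
    linear_combination x ^ (m + n + 3) * e
      - x ^ (m + n + 2) * (Polynomial.aeval x a + Polynomial.aeval x b * w) * hxu
      + x ^ (m + n) * Polynomial.aeval u b' * w * hu3
  obtain ⟨h1, h2⟩ := h.eq_zero_of_add_mul_eq_zero hz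
  have hb0 : b = 0 := by
    by_contra hb0
    have hd := congrArg Polynomial.natDegree (sub_eq_zero.1 h2)
    rw [Polynomial.natDegree_mul_X_pow _ hb0] at hd
    have : (b'.reverse * Polynomial.X ^ m).natDegree ≤ n + m :=
      Polynomial.natDegree_mul_le.trans
        (add_le_add (Polynomial.reverse_natDegree_le _) (Polynomial.natDegree_X_pow_le _))
    omega
  have ha1 : a.natDegree ≤ 1 := by
    by_cases ha0 : a = 0
    · simp [ha0]
    have hd := congrArg Polynomial.natDegree (sub_eq_zero.1 h1)
    rw [Polynomial.natDegree_mul_X_pow _ ha0] at hd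
    have : (a'.reverse * Polynomial.X ^ (n + 3)).natDegree ≤ m + (n + 3) :=
      Polynomial.natDegree_mul_le.trans
        (add_le_add (Polynomial.reverse_natDegree_le _) (Polynomial.natDegree_X_pow_le _))
    omega
  refine ⟨a.coeff 0, a.coeff 1, ?_⟩
  rw [hb0, map_zero, zero_mul, add_zero]
  conv_lhs => rw [Polynomial.eq_X_add_C_of_natDegree_le_one ha1]
  simp [add_comm]

/-- A function field with an everywhere nonsingular affine hyperelliptic model `w ^ 2 = f(x)` whose
chart at infinity `v ^ 2 = f'(u)`, `u = 1 / x`, `v = w / x ^ 3`, is also nonsingular has genus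
two. -/
theorem functionFieldGenus_eq_two [CharZero k] (h : IsHyperellipticModel x w f)
    (h' : IsHyperellipticModel u v f') (hxu : x * u = 1) (hvw : v = w * u ^ 3) :
    functionFieldGenus k F = 2 := by
  have hx : x ≠ 0 := left_ne_zero_of_mul_eq_one hxu
  have hw := h.ne_zero
  have hux : u = x⁻¹ := eq_inv_of_mul_eq_one_right hxu
  obtain ⟨η, hη⟩ : ∃ η, η = w⁻¹ • D k F x := ⟨_, rfl⟩
  have hη0 : η ≠ 0 := hη ▸ h.inv_smul_D_ne_zero
  -- `du = -dx / x ^ 2` and `v = w / x ^ 3`.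
  have hη' : v⁻¹ • D k F u = -(x • η) := by
    rw [hux, Derivation.leibniz_inv, hη, hvw, hux, smul_smul, smul_smul, ← neg_smul]
    congr 1
    field_simp
  have hli : LinearIndependent k ![η, x • η] := by
    rw [LinearIndependent.pair_iff]
    intro s t e
    rw [← algebraMap_smul F s, ← algebraMap_smul F t, smul_smul, ← add_smul,
      smul_eq_zero_iff_left hη0] at e
    have : Polynomial.C s + Polynomial.C t * Polynomial.X = 0 := h.aeval_eq_zero (by simpa using e)
    have h0 := congrArg (Polynomial.coeff · 0) this
    have h1 := congrArg (Polynomial.coeff · 1) this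
    simp [Polynomial.coeff_C] at h0 h1
    exact ⟨h0, h1⟩
  have hspan : regularDifferentials k F = Submodule.span k (Set.range ![η, x • η]) := by
    rw [Matrix.range_cons, Matrix.range_cons, Matrix.range_empty, Set.union_empty,
      Set.singleton_union]
    apply le_antisymm
    · intro ω hω
      obtain ⟨s, rfl⟩ := h.exists_eq_smul ω
      obtain ⟨a, b, rfl⟩ := h.exists_eq_of_smul_mem hω
      rw [← hη] at hω ⊢
      have h2 : (Polynomial.aeval x a + Polynomial.aeval x b * w) • η =
          (-(u * (Polynomial.aeval x a + Polynomial.aeval x b * w))) • (v⁻¹ • D k F u) := by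
        rw [hη', smul_neg, neg_smul, neg_neg, smul_smul, mul_right_comm, mul_comm u x, hxu, one_mul]
      rw [h2] at hω
      obtain ⟨a', b', e⟩ := h'.exists_eq_of_smul_mem hω
      obtain ⟨c, d, e'⟩ := h.exists_linear_of_chart_change hxu hvw (a' := -a') (b' := -b')
        (a := a) (b := b) (by simp only [map_neg]; linear_combination -e)
      rw [e', Submodule.mem_span_pair]
      exact ⟨c, d, by rw [add_smul, mul_smul, algebraMap_smul, algebraMap_smul]⟩
    · rw [Submodule.span_le, Set.pair_subset_iff]
      suffices ∀ O : ValuationSubring F, (∀ c : k, algebraMap k F c ∈ O) →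
          η ∈ regularDifferentialsAt k F O ∧ x • η ∈ regularDifferentialsAt k F O by
        simp only [regularDifferentials, SetLike.mem_coe, Submodule.mem_iInf]
        exact ⟨fun O hO => (this O hO).1, fun O hO => (this O hO).2⟩
      intro O hO
      -- Every valuation ring contains `x` or `1 / x`, so one of the two charts always applies.
      rcases O.mem_or_inv_mem x with hxO | hxO
      · refine ⟨?_, hη ▸ h.inv_smul_D_mem hO hxO hxO⟩
        rw [← one_smul F η, hη]
        exact h.inv_smul_D_mem hO hxO O.one_mem
      · rw [← hux] at hxO
        have h1 := h'.inv_smul_D_mem hO hxO hxO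
        have h2 := h'.inv_smul_D_mem hO hxO O.one_mem
        rw [hη', smul_neg, smul_smul, mul_comm, hxu, one_smul] at h1
        rw [hη', one_smul] at h2
        exact ⟨(neg_mem_iff).1 h1, (neg_mem_iff).1 h2⟩
  rw [functionFieldGenus, hspan, finrank_span_eq_card hli, Fintype.card_fin]

end IsHyperellipticModel

/-! ### Transport of models between fields and charts. -/

namespace IsHyperellipticModel

variable {k F K : Type*} [Field k] [Field F] [Algebra k F] [Field K] [Algebra k K]

/-- The image of `ι` contains generators of `K`, so `ι` is onto and the model descends. -/
theorem of_map {x w : F} {f : k[X]} (ι : F →ₐ[k] K) (h : IsHyperellipticModel (ι x) (ι w) f) :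
    IsHyperellipticModel x w f where
  transcendental hx := h.transcendental ((isAlgebraic_algHom_iff ι ι.injective).2 hx)
  sq_eq := ι.injective <| by
    change ι (w ^ 2) = ι (Polynomial.aeval x f)
    rw [map_pow, h.sq_eq, Polynomial.aeval_algHom_apply]
  separable := h.separable
  eq_zero_of_sq_eq := h.eq_zero_of_sq_eq
  adjoin_eq_top := by
    rw [eq_top_iff]
    rintro s -
    have hs : ι s ∈ (IntermediateField.adjoin k {x, w}).map ι := by
      rw [IntermediateField.adjoin_map, Set.image_pair, h.adjoin_eq_top]
      trivial
    obtain ⟨t, ht, e⟩ := hs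
    rwa [← ι.injective e]

theorem inv {x w : F} {f f' : k[X]} (h : IsHyperellipticModel x w f)
    (hff' : Polynomial.aeval x f * (x⁻¹) ^ 6 = Polynomial.aeval x⁻¹ f') (hs : f'.Separable)
    (h0 : ∀ a b : k[X], a ^ 2 = b ^ 2 * f' → b = 0) :
    IsHyperellipticModel x⁻¹ (w * x⁻¹ ^ 3) f' where
  transcendental hx := h.transcendental (IsAlgebraic.inv_iff.1 hx)
  sq_eq := by rw [← hff', ← h.sq_eq]; ring
  separable := hs
  eq_zero_of_sq_eq := h0
  adjoin_eq_top := by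
    have hx : x ≠ 0 := fun hx => h.transcendental (hx ▸ isAlgebraic_zero)
    rw [eq_top_iff, ← h.adjoin_eq_top, IntermediateField.adjoin_le_iff, Set.pair_subset_iff]
    have h1 : x⁻¹ ∈ IntermediateField.adjoin k {x⁻¹, w * x⁻¹ ^ 3} :=
      IntermediateField.subset_adjoin _ _ (by simp)
    have h2 : w * x⁻¹ ^ 3 ∈ IntermediateField.adjoin k {x⁻¹, w * x⁻¹ ^ 3} :=
      IntermediateField.subset_adjoin _ _ (by simp)
    constructor
    · simpa using inv_mem h1
    · have : w = (w * x⁻¹ ^ 3) * (x⁻¹)⁻¹ ^ 3 := by field_simp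
      have h3 := mul_mem h2 (pow_mem (inv_mem h1) 3)
      rwa [← this] at h3

end IsHyperellipticModel

/-! ### Odd degree or an odd order of vanishing excludes squares. -/

section ParityOfMultiplicities

variable {k : Type*} [Field k]

theorem eq_zero_of_sq_eq_of_odd_natDegree {f a b : k[X]} (hf : Odd f.natDegree)
    (h : a ^ 2 = b ^ 2 * f) : b = 0 := by
  by_contra hb
  have hf0 : f ≠ 0 := by rintro rfl; simp at hf
  have := congrArg Polynomial.natDegree h
  rw [Polynomial.natDegree_mul (pow_ne_zero 2 hb) hf0, Polynomial.natDegree_pow,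
    Polynomial.natDegree_pow] at this
  obtain ⟨m, hm⟩ := hf
  omega

theorem eq_zero_of_sq_eq_of_X_mul {s a b : k[X]} (hs : s.coeff 0 ≠ 0)
    (h : a ^ 2 = b ^ 2 * (Polynomial.X * s)) : b = 0 := by
  by_contra hb
  have hs0 : s ≠ 0 := by rintro rfl; simp at hs
  have ha : a ≠ 0 := by
    rintro rfl
    rw [zero_pow two_ne_zero, eq_comm] at h
    exact mul_ne_zero (pow_ne_zero 2 hb) (mul_ne_zero Polynomial.X_ne_zero hs0) h
  have h1 := congrArg Polynomial.natTrailingDegree h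
  rw [Polynomial.natTrailingDegree_mul (pow_ne_zero 2 hb) (mul_ne_zero Polynomial.X_ne_zero hs0),
    Polynomial.natTrailingDegree_mul Polynomial.X_ne_zero hs0, sq, sq,
    Polynomial.natTrailingDegree_mul hb hb, Polynomial.natTrailingDegree_mul ha ha,
    Polynomial.natTrailingDegree_X,
    Polynomial.natTrailingDegree_eq_zero_of_constantCoeff_ne_zero hs] at h1
  omega

end ParityOfMultiplicities

/-! ### The function field of `w ^ 2 = f(x)` and specialisation at its points. -/

section DoubleCover

variable {k : Type*} [Field k]

/-- The ring `k[x, w] / (w ^ 2 - f(x))`. -/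
abbrev DoubleCover (f : k[X]) : Type _ :=
  AdjoinRoot (Polynomial.X ^ 2 - Polynomial.C f : k[X][X])

/-- A monic quadratic over a domain factors only if it has a root; a root `c` would satisfy `c ^ 2 =
f`, against `h0` with `b = 1`. -/
theorem prime_X_sq_sub_C {f : k[X]} (h0 : ∀ a b : k[X], a ^ 2 = b ^ 2 * f → b = 0) :
    Prime (Polynomial.X ^ 2 - Polynomial.C f : k[X][X]) := by
  refine Irreducible.prime ?_
  have hm : (Polynomial.X ^ 2 - Polynomial.C f : k[X][X]).Monic :=
    Polynomial.monic_X_pow_sub_C _ two_ne_zero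
  rw [hm.irreducible_iff_roots_eq_zero_of_degree_le_three (by simp) (by simp)]
  refine Multiset.eq_zero_of_forall_notMem fun c hc => ?_
  have hc := Polynomial.isRoot_of_mem_roots hc
  simp only [Polynomial.IsRoot, Polynomial.eval_sub, Polynomial.eval_pow, Polynomial.eval_X,
    Polynomial.eval_C] at hc
  exact one_ne_zero (h0 c 1 (by linear_combination hc))

variable {f : k[X]} {K : Type*} [Field K] [Algebra k K] [Algebra (DoubleCover f) K]
  [IsScalarTower k (DoubleCover f) K] [IsFractionRing (DoubleCover f) K]

theorem isHyperellipticModel_doubleCover (hs : f.Separable)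
    (h0 : ∀ a b : k[X], a ^ 2 = b ^ 2 * f → b = 0) :
    IsHyperellipticModel (k := k)
      (algebraMap (DoubleCover f) K (AdjoinRoot.of _ Polynomial.X))
      (algebraMap (DoubleCover f) K (AdjoinRoot.root _)) f := by
  have haev : ∀ a : k[X], Polynomial.aeval (algebraMap (DoubleCover f) K
      (AdjoinRoot.of _ Polynomial.X)) a = algebraMap (DoubleCover f) K (AdjoinRoot.of _ a) := by
    intro a
    induction a using Polynomial.induction_on' with
    | add p q hp hq => simp only [map_add, hp, hq]
    | monomial n c =>
      rw [Polynomial.aeval_monomial, ← Polynomial.C_mul_X_pow_eq_monomial, map_mul, map_mul,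
        map_pow, map_pow, IsScalarTower.algebraMap_apply k (DoubleCover f) K]
      rfl
  refine ⟨?_, ?_, hs, h0, ?_⟩
  · rw [transcendental_iff]
    intro p hp
    rw [haev] at hp
    have h1 := (IsFractionRing.injective (DoubleCover f) K) (hp.trans (map_zero _).symm)
    have h2 := AdjoinRoot.mk_eq_zero.1 (show AdjoinRoot.mk _ (Polynomial.C p) = 0 from h1)
    by_contra hp0
    have := Polynomial.natDegree_le_of_dvd h2 (by simpa using hp0)
    simp at this
  · rw [haev, ← map_pow]
    congr 1
    have := AdjoinRoot.mk_self (f := (Polynomial.X ^ 2 - Polynomial.C f : k[X][X]))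
    rw [map_sub, map_pow, AdjoinRoot.mk_X, AdjoinRoot.mk_C, sub_eq_zero] at this
    exact this
  · rw [eq_top_iff]
    rintro s -
    set S := IntermediateField.adjoin k {algebraMap (DoubleCover f) K
      (AdjoinRoot.of _ Polynomial.X), algebraMap (DoubleCover f) K (AdjoinRoot.root _)} with hS
    have hx : algebraMap (DoubleCover f) K (AdjoinRoot.of _ Polynomial.X) ∈ S :=
      IntermediateField.subset_adjoin _ _ (by simp)
    have hw : algebraMap (DoubleCover f) K (AdjoinRoot.root _) ∈ S :=
      IntermediateField.subset_adjoin _ _ (by simp)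
    have hp : ∀ p : k[X], algebraMap (DoubleCover f) K (AdjoinRoot.of _ p) ∈ S := by
      intro p
      rw [← haev]
      exact IntermediateField.algebra_adjoin_le_adjoin _ _
        ((Algebra.adjoin_mono (by simp)) (Polynomial.aeval_mem_adjoin_singleton k _))
    have hb : ∀ b : DoubleCover f, algebraMap (DoubleCover f) K b ∈ S := by
      intro b
      induction b using AdjoinRoot.induction_on with
      | ih p =>
        induction p using Polynomial.induction_on' with
        | add p q hp hq => rw [map_add, map_add]; exact add_mem hp hq
        | monomial n c =>
          rw [← Polynomial.C_mul_X_pow_eq_monomial, map_mul, map_pow, AdjoinRoot.mk_X,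
            AdjoinRoot.mk_C, map_mul, map_pow]
          exact mul_mem (hp c) (pow_mem hw n)
    obtain ⟨a, b, -, rfl⟩ := IsFractionRing.div_surjective (A := DoubleCover f) s
    exact div_mem (hb a) (hb b)

/-- A polynomial relation between two fractions with the same denominator specialises. -/
theorem aeval_specialization {k B K L : Type*} [CommRing k] [CommRing B] [Algebra k B] [Field K]
    [Algebra k K] [Field L] [Algebra k L] (ι : B →ₐ[k] K) (hι : Function.Injective ι)
    (ev : B →ₐ[k] L) {σ : Type*} (p : σ → B) (d : B) (hd : ev d ≠ 0) (P : MvPolynomial σ k)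
    (hP : aeval (fun i => ι (p i) / ι d) P = 0) : aeval (fun i => ev (p i) / ev d) P = 0 := by
  have hd' : ι d ≠ 0 := fun h => hd (by
    rw [hι (h.trans (map_zero ι).symm), map_zero])
  -- Clearing denominators yields one element `b` of `B` whose images under `ι` and `ev` are the two
  -- cleared values; it is zero because `ι` is injective.
  have h : ∃ (N : ℕ) (b : B), ι b = ι d ^ N * aeval (fun i => ι (p i) / ι d) P ∧
      ev b = ev d ^ N * aeval (fun i => ev (p i) / ev d) P := by
    clear hP
    induction P using MvPolynomial.induction_on with
    | C a => exact ⟨0, algebraMap k B a, by simp, by simp⟩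
    | add P Q hP hQ =>
      obtain ⟨N, b, h1, h2⟩ := hP
      obtain ⟨M, c, h3, h4⟩ := hQ
      refine ⟨N + M, d ^ M * b + d ^ N * c, ?_, ?_⟩
      · simp only [map_add, map_mul, map_pow, h1, h3]; ring
      · simp only [map_add, map_mul, map_pow, h2, h4]; ring
    | mul_X P i hP =>
      obtain ⟨N, b, h1, h2⟩ := hP
      refine ⟨N + 1, b * p i, ?_, ?_⟩
      · simp only [map_mul, h1, aeval_X, pow_succ]; field_simp
      · simp only [map_mul, h2, aeval_X, pow_succ]; field_simp
  obtain ⟨N, b, h1, h2⟩ := h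
  rw [hP, mul_zero] at h1
  rw [hι (h1.trans (map_zero ι).symm), map_zero] at h2
  exact (mul_eq_zero.1 h2.symm).resolve_left (pow_ne_zero N hd)

end DoubleCover

/-! ### Irreducibility and function field of a parametrised plane curve. -/

section PlaneCurves

/-- `g` as a polynomial in `y` with coefficients in `ℂ[z]`. -/
noncomputable def toBivariate : Poly ≃ₐ[ℂ] ℂ[X][X] := (Polynomial.Bivariate.equivMvPolynomial ℂ).symm

theorem toBivariate_symm_C (q : ℂ[X]) :
    toBivariate.symm (Polynomial.C q) = Polynomial.aeval z q := by
  induction q using Polynomial.induction_on' with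
  | add p q hp hq => simp only [map_add, hp, hq]
  | monomial n c =>
    rw [← Polynomial.C_mul_X_pow_eq_monomial]
    simp [toBivariate, z]

theorem eval_evalEval_toBivariate (g : Poly) (c d : ℂ) :
    Polynomial.evalEval c d (toBivariate g) = eval ![c, d] g := by
  induction g using MvPolynomial.induction_on with
  | C a => simp [toBivariate]
  | add p q hp hq => simp only [map_add, Polynomial.evalEval_add, hp, hq]
  | mul_X p i hp =>
    simp only [map_mul, Polynomial.evalEval_mul, hp, eval_X]
    fin_cases i <;> simp [toBivariate, Polynomial.evalEval]

/-- If `g = a b` with monic factors, `φ` kills one of them. On the line `z = c` that factor has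
every element of `S` as a root, so it has the full degree in `y` and the other factor is trivial. -/
theorem irreducible_of_specialization {g : Poly} {A : Type*} [CommRing A] [IsDomain A]
    (φ : Poly →+* A) (hm : (toBivariate g).Monic) (hφ : φ g = 0) (c : ℂ) (S : Finset ℂ)
    (hS : (toBivariate g).natDegree ≤ S.card) (hpos : (toBivariate g).natDegree ≠ 0)
    (hspec : ∀ p : Poly, φ p = 0 → ∀ d ∈ S, eval ![c, d] p = 0) : Irreducible g := by
  rw [← MulEquiv.irreducible_iff toBivariate, hm.irreducible_iff_natDegree]
  refine ⟨fun h => by simp [h] at hpos, fun a b ha hb hab => ?_⟩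
  have key : ∀ p : ℂ[X][X], p.Monic → φ (toBivariate.symm p) = 0 → S.card ≤ p.natDegree := by
    intro p hp h0
    have hp' := hp.map (Polynomial.evalRingHom c)
    rw [← hp.natDegree_map (Polynomial.evalRingHom c)]
    refine Polynomial.card_le_degree_of_subset_roots fun d hd => ?_
    rw [Polynomial.mem_roots hp'.ne_zero, Polynomial.IsRoot, ← hspec _ h0 d hd,
      ← eval_evalEval_toBivariate, AlgEquiv.apply_symm_apply, Polynomial.eval_map,
      Polynomial.eval₂_evalRingHom]
  rw [← hab, ha.natDegree_mul hb] at hS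
  have : φ (toBivariate.symm a) * φ (toBivariate.symm b) = 0 := by
    rw [← map_mul, ← map_mul, hab, AlgEquiv.symm_apply_apply, hφ]
  rcases mul_eq_zero.1 this with h | h
  · have := key a ha h
    right; omega
  · have := key b hb h
    left; omega

/-- The domain `ℂ[z, y] / (g)` is finite over `ℂ[z]`, so a nonzero ideal meets `ℂ[z]` nontrivially.
The kernel of the induced map does not, as the image of `z` is transcendental. -/
theorem dvd_of_map_eq_zero {g : Poly} {K : Type*} [Field K] [Algebra ℂ K] (φ : Poly →ₐ[ℂ] K)
    (hg : Irreducible g) (hm : (toBivariate g).Monic) (hφ : φ g = 0)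
    (ht : Transcendental ℂ (φ z)) {p : Poly} (hp : φ p = 0) : g ∣ p := by
  set G := toBivariate g with hG
  have hprime : Prime G := ((MulEquiv.irreducible_iff toBivariate).2 hg).prime
  have : IsDomain (AdjoinRoot G) := AdjoinRoot.isDomain_of_prime hprime
  have : Module.Finite ℂ[X] (AdjoinRoot G) := hm.finite_adjoinRoot
  let Φ : ℂ[X][X] →+* K := (φ.comp toBivariate.symm.toAlgHom).toRingHom
  have hΦ : ∀ q, Φ q = φ (toBivariate.symm q) := fun _ => rfl
  let ψ : AdjoinRoot G →+* K := Ideal.Quotient.lift (Ideal.span {G}) Φ fun q hq => by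
    obtain ⟨r, rfl⟩ := Ideal.mem_span_singleton.1 hq
    rw [map_mul, hΦ, hG, AlgEquiv.symm_apply_apply, hφ, zero_mul]
  have hψ : ∀ q, ψ (AdjoinRoot.mk G q) = φ (toBivariate.symm q) := fun _ => rfl
  have hker : RingHom.ker ψ = ⊥ := by
    refine Ideal.eq_bot_of_comap_eq_bot (R := ℂ[X]) ?_
    rw [eq_bot_iff]
    intro q hq
    have h0 : φ (toBivariate.symm (Polynomial.C q)) = 0 := hq
    rw [toBivariate_symm_C, ← Polynomial.aeval_algHom_apply] at h0
    exact (transcendental_iff.1 ht) q h0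
  have h1 : AdjoinRoot.mk G (toBivariate p) ∈ RingHom.ker ψ := by
    rw [RingHom.mem_ker, hψ, AlgEquiv.symm_apply_apply, hp]
  rw [hker, Ideal.mem_bot, AdjoinRoot.mk_eq_zero] at h1
  exact (map_dvd_iff toBivariate).1 h1

/-- The function field of `g = 0` embeds in `K` through `φ`; its image contains `x` and `w`, so both
charts descend to it. -/
theorem curveGenus_eq_two {g : Poly} {K : Type*} [Field K] [Algebra ℂ K] (φ : Poly →ₐ[ℂ] K)
    (hg : Irreducible g) (hφ : ∀ p, φ p = 0 ↔ g ∣ p) {x w : K} {f f' : ℂ[X]}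
    (h : IsHyperellipticModel x w f) (h' : IsHyperellipticModel x⁻¹ (w * x⁻¹ ^ 3) f')
    (hx : x ∈ IntermediateField.adjoin ℂ (Set.range φ))
    (hw : w ∈ IntermediateField.adjoin ℂ (Set.range φ)) : curveGenus g hg = 2 := by
  have := isDomain_coordinateRing hg
  let ψ : CoordinateRing g →ₐ[ℂ] K := Ideal.Quotient.liftₐ _ φ fun p hp =>
    (hφ p).2 (Ideal.mem_span_singleton.1 hp)
  have hψ : Function.Injective ψ := by
    rw [injective_iff_map_eq_zero]
    intro p
    obtain ⟨p, rfl⟩ := Ideal.Quotient.mk_surjective p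
    intro hp
    rw [Ideal.Quotient.eq_zero_iff_mem, Ideal.mem_span_singleton]
    exact (hφ p).1 hp
  let ι : FractionRing (CoordinateRing g) →ₐ[ℂ] K := IsFractionRing.liftAlgHom (g := ψ) hψ
  have hι : ∀ p : Poly, φ p ∈ ι.fieldRange := fun p =>
    ⟨algebraMap _ _ (Ideal.Quotient.mk _ p), IsFractionRing.lift_algebraMap hψ _⟩
  have hle : IntermediateField.adjoin ℂ (Set.range φ) ≤ ι.fieldRange := by
    rw [IntermediateField.adjoin_le_iff]
    rintro _ ⟨p, rfl⟩
    exact hι p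
  obtain ⟨x, rfl⟩ := hle hx
  obtain ⟨w, rfl⟩ := hle hw
  have hx0 : x ≠ 0 := by
    rintro rfl
    exact h.transcendental (by simpa using isAlgebraic_zero)
  refine IsHyperellipticModel.functionFieldGenus_eq_two (x := x) (w := w) (u := x⁻¹)
    (v := w * x⁻¹ ^ 3) (.of_map ι h) (.of_map (f := f') ι ?_) (mul_inv_cancel₀ hx0) rfl
  rw [map_mul, map_pow, map_inv₀]
  exact h'

end PlaneCurves

/-- A relation satisfied by the functions `w n(x) / r(x)` and `w t(x) / r(x) ^ 2` on the curve
`w ^ 2 = f(x)` holds for their values at every point where `r` does not vanish. -/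
theorem eval_eq_zero_of_aeval_doubleCover {k K : Type*} [Field k] [Field K] [Algebra k K]
    {f n r t : k[X]}
    [Algebra (DoubleCover f) K] [IsScalarTower k (DoubleCover f) K] [IsFractionRing (DoubleCover f) K]
    (h0 : ∀ a b : k[X], a ^ 2 = b ^ 2 * f → b = 0) (hs : f.Separable) {x w : K}
    (hx : x = algebraMap (DoubleCover f) K (AdjoinRoot.of _ Polynomial.X))
    (hw : w = algebraMap (DoubleCover f) K (AdjoinRoot.root _))
    {P : MvPolynomial (Fin 2) k}
    (hP : aeval ![w * Polynomial.aeval x n / Polynomial.aeval x r,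
      w * Polynomial.aeval x t / Polynomial.aeval x r ^ 2] P = 0)
    {u₀ w₀ : k} (hu : w₀ ^ 2 = f.eval u₀) (hr : r.eval u₀ ≠ 0) :
    eval ![w₀ * n.eval u₀ / r.eval u₀, w₀ * t.eval u₀ / r.eval u₀ ^ 2] P = 0 := by
  have hmod : IsHyperellipticModel (k := k) x w f := by
    rw [hx, hw]; exact isHyperellipticModel_doubleCover hs h0
  have hr0 : r ≠ 0 := by rintro rfl; simp at hr
  have hrx : Polynomial.aeval x r ≠ 0 := fun h => hr0 (hmod.aeval_eq_zero h)
  have haev : ∀ a : k[X], algebraMap (DoubleCover f) K (AdjoinRoot.of _ a) =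
      Polynomial.aeval x a := by
    intro a
    induction a using Polynomial.induction_on' with
    | add p q hp hq => simp only [map_add, hp, hq]
    | monomial n c =>
      rw [Polynomial.aeval_monomial, ← Polynomial.C_mul_X_pow_eq_monomial, map_mul, map_mul,
        map_pow, map_pow, IsScalarTower.algebraMap_apply k (DoubleCover f) K, hx]
      rfl
  let ev : DoubleCover f →ₐ[k] k := AdjoinRoot.liftAlgHom _ (Polynomial.aeval u₀) w₀ (by
    simp [hu, Polynomial.eval₂_eq_eval_map])
  have hev : ∀ a : k[X], ev (AdjoinRoot.of _ a) = a.eval u₀ := fun a => by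
    simp [ev, Polynomial.aeval_def, Polynomial.eval₂_eq_eval_map]
  have hevw : ev (AdjoinRoot.root _) = w₀ := by simp [ev]
  have hinj := IsFractionRing.injective (DoubleCover f) K
  -- Over the common denominator `r ^ 2` the numerators are `w n r` and `w t`.
  have key := aeval_specialization (IsScalarTower.toAlgHom k (DoubleCover f) K) hinj ev
    ![AdjoinRoot.root _ * AdjoinRoot.of _ n * AdjoinRoot.of _ r,
      AdjoinRoot.root _ * AdjoinRoot.of _ t] (AdjoinRoot.of _ (r ^ 2))
    (by rw [hev]; simpa using hr) P
  have e1 : (fun i => IsScalarTower.toAlgHom k (DoubleCover f) K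
      ((![AdjoinRoot.root _ * AdjoinRoot.of _ n * AdjoinRoot.of _ r,
        AdjoinRoot.root _ * AdjoinRoot.of _ t] : Fin 2 → DoubleCover f) i) /
        IsScalarTower.toAlgHom k (DoubleCover f) K (AdjoinRoot.of _ (r ^ 2))) =
      ![w * Polynomial.aeval x n / Polynomial.aeval x r,
        w * Polynomial.aeval x t / Polynomial.aeval x r ^ 2] := by
    funext i
    fin_cases i
    · simp only [IsScalarTower.coe_toAlgHom', haev]
      simp [haev, ← hw]
      field_simp
    · simp [haev, ← hw]
  have e2 : (fun i => ev ((![AdjoinRoot.root _ * AdjoinRoot.of _ n * AdjoinRoot.of _ r,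
        AdjoinRoot.root _ * AdjoinRoot.of _ t] : Fin 2 → DoubleCover f) i) /
        ev (AdjoinRoot.of _ (r ^ 2))) =
      ![w₀ * n.eval u₀ / r.eval u₀, w₀ * t.eval u₀ / r.eval u₀ ^ 2] := by
    funext i
    fin_cases i
    · simp only [hev]
      simp [hev, hevw]
      field_simp
    · simp only [hev]
      simp [hev, hevw]
  rw [e1, e2] at key
  exact key hP

/-- The criterion applied to both curves. The identities are assumed over all fields because the
function field `K` is only built inside the proof; `N / D` recovers `x`. -/
theorem exists_curveGenus_eq_two {g G N D : Poly} (θ : Poly ≃ₐ[ℂ] Poly)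
    (hθ : Associated (θ g) G) {f f' n r t : ℂ[X]} (hm : (toBivariate G).Monic)
    (hdeg : (toBivariate G).natDegree = 5) (hs : f.Separable)
    (h0 : ∀ a b : ℂ[X], a ^ 2 = b ^ 2 * f → b = 0) (hs' : f'.Separable)
    (h0' : ∀ a b : ℂ[X], a ^ 2 = b ^ 2 * f' → b = 0)
    (hff' : ∀ {K : Type} [Field K] [Algebra ℂ K] (x : K), x ≠ 0 →
      Polynomial.aeval x f * x⁻¹ ^ 6 = Polynomial.aeval x⁻¹ f')
    (hn : n ≠ 0)
    (hG : ∀ {K : Type} [Field K] [Algebra ℂ K] {x w : K}, w ^ 2 = Polynomial.aeval x f →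
      Polynomial.aeval x r ≠ 0 →
      aeval ![w * Polynomial.aeval x n / Polynomial.aeval x r,
        w * Polynomial.aeval x t / Polynomial.aeval x r ^ 2] G = 0)
    (hN : ∀ {K : Type} [Field K] [Algebra ℂ K] {x w : K}, w ^ 2 = Polynomial.aeval x f →
      Polynomial.aeval x r ≠ 0 →
      aeval ![w * Polynomial.aeval x n / Polynomial.aeval x r,
        w * Polynomial.aeval x t / Polynomial.aeval x r ^ 2] N =
      x * aeval ![w * Polynomial.aeval x n / Polynomial.aeval x r,
        w * Polynomial.aeval x t / Polynomial.aeval x r ^ 2] D)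
    (hD : eval ![0, 0] D ≠ 0) {S : Finset ℂ} (hS : S.card = 5) (h0S : 0 ∈ S)
    (hpt : ∀ d ∈ S, ∃ u₀ w₀ : ℂ, w₀ ^ 2 = f.eval u₀ ∧ r.eval u₀ ≠ 0 ∧
      w₀ * n.eval u₀ / r.eval u₀ = 0 ∧ w₀ * t.eval u₀ / r.eval u₀ ^ 2 = d) :
    ∃ h : Irreducible g, curveGenus g h = 2 := by
  have : IsDomain (DoubleCover f) := AdjoinRoot.isDomain_of_prime (prime_X_sq_sub_C h0)
  let K := FractionRing (DoubleCover f)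
  obtain ⟨x, hx⟩ : ∃ x : K, x = algebraMap (DoubleCover f) K (AdjoinRoot.of _ Polynomial.X) :=
    ⟨_, rfl⟩
  obtain ⟨w, hw⟩ : ∃ w : K, w = algebraMap (DoubleCover f) K (AdjoinRoot.root _) := ⟨_, rfl⟩
  have hmod : IsHyperellipticModel (k := ℂ) x w f := by
    rw [hx, hw]; exact isHyperellipticModel_doubleCover hs h0
  have hx0 : x ≠ 0 := fun h => hmod.transcendental (h ▸ isAlgebraic_zero)
  have hmod' := hmod.inv (hff' x hx0) hs' h0'
  have hr : r ≠ 0 := by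
    rintro rfl
    obtain ⟨_, _, -, h, -⟩ := hpt 0 h0S
    simp at h
  have hrx : Polynomial.aeval x r ≠ 0 := fun h => hr (hmod.aeval_eq_zero h)
  have hnx : Polynomial.aeval x n ≠ 0 := fun h => hn (hmod.aeval_eq_zero h)
  let φ : Poly →ₐ[ℂ] K := aeval ![w * Polynomial.aeval x n / Polynomial.aeval x r,
        w * Polynomial.aeval x t / Polynomial.aeval x r ^ 2]
  have hφz : φ z = w * Polynomial.aeval x n / Polynomial.aeval x r := by simp [φ, z]
  have hφG : φ G = 0 := hG hmod.sq_eq hrx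
  have hspec : ∀ p : Poly, φ p = 0 → ∀ d ∈ S, eval ![0, d] p = 0 := by
    intro p hp d hd
    obtain ⟨u₀, w₀, h1, h2, h3, h4⟩ := hpt d hd
    have := eval_eq_zero_of_aeval_doubleCover h0 hs hx hw hp h1 h2
    rwa [h3, h4] at this
  have hGirr : Irreducible G := irreducible_of_specialization φ.toRingHom hm hφG 0 S
    (by rw [hdeg, hS]) (by rw [hdeg]; norm_num) hspec
  have hg : Irreducible g :=
    (MulEquiv.irreducible_iff θ).1 (hθ.irreducible_iff.2 hGirr)
  have hZ : Transcendental ℂ (φ z) := by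
    -- If `z` were algebraic it would be a constant `c`, and `w n = c r` contradicts the
    -- independence of `1` and `w` over `k[x]`.
    intro hZ
    obtain ⟨c, hc⟩ := minpoly.mem_range_of_degree_eq_one ℂ (φ z)
      (IsAlgClosed.degree_eq_one_of_irreducible ℂ (minpoly.irreducible hZ.isIntegral))
    rw [hφz, eq_div_iff hrx] at hc
    refine hn (hmod.eq_zero_of_add_mul_eq_zero (a := -(Polynomial.C c * r)) ?_).2
    simp only [map_neg, map_mul, Polynomial.aeval_C]
    linear_combination -hc
  have hker : ∀ p, φ p = 0 ↔ G ∣ p := fun p =>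
    ⟨fun hp => dvd_of_map_eq_zero φ hGirr hm hφG hZ hp, fun ⟨q, hq⟩ => by
      rw [hq, map_mul, hφG, zero_mul]⟩
  have hrange : ∀ p, φ p ∈ IntermediateField.adjoin ℂ (Set.range (φ.comp θ.toAlgHom)) :=
    fun p => IntermediateField.subset_adjoin _ _ ⟨θ.symm p, by simp⟩
  have hxL : x ∈ IntermediateField.adjoin ℂ (Set.range (φ.comp θ.toAlgHom)) := by
    -- Otherwise `D` would vanish at `(0, 0)`, which is on the parametrised curve since `0 ∈ S`.
    have hD0 : φ D ≠ 0 := fun h => hD (hspec D h 0 h0S)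
    have : x = φ N / φ D := by
      rw [eq_div_iff hD0]
      exact (hN hmod.sq_eq hrx).symm
    rw [this]
    exact div_mem (hrange N) (hrange D)
  have hpL : ∀ p : ℂ[X], Polynomial.aeval x p ∈
      IntermediateField.adjoin ℂ (Set.range (φ.comp θ.toAlgHom)) := fun p => by
    induction p using Polynomial.induction_on' with
    | add p q hp hq => rw [map_add]; exact add_mem hp hq
    | monomial n c =>
      rw [Polynomial.aeval_monomial]
      exact mul_mem (IntermediateField.algebraMap_mem _ c) (pow_mem hxL n)
  have hwL : w ∈ IntermediateField.adjoin ℂ (Set.range (φ.comp θ.toAlgHom)) := by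
    have : w = φ z * Polynomial.aeval x r / Polynomial.aeval x n := by
      rw [hφz, div_mul_cancel₀ _ hrx, mul_div_cancel_right₀ _ hnx]
    rw [this]
    exact div_mem (mul_mem (hrange z) (hpL r)) (hpL n)
  refine ⟨hg, curveGenus_eq_two (φ.comp θ.toAlgHom) hg (fun p => ?_) hmod hmod' hxL hwL⟩
  rw [← map_dvd_iff θ, hθ.dvd_iff_dvd_left]
  exact hker (θ p)

/-! ### Rescaling, separability and degree tools. -/

/-- The linear change of coordinates `z ↦ a z`, `y ↦ b y`. -/
noncomputable def scale (a b : ℂˣ) : Poly ≃ₐ[ℂ] Poly :=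
  .ofAlgHom (aeval ![C (a : ℂ) * z, C (b : ℂ) * y])
    (aeval ![C ((a⁻¹ : ℂˣ) : ℂ) * z, C ((b⁻¹ : ℂˣ) : ℂ) * y])
    (by
      apply MvPolynomial.algHom_ext
      intro i
      fin_cases i <;> simp [z, y, ← mul_assoc, ← C_mul, algebraMap_eq])
    (by
      apply MvPolynomial.algHom_ext
      intro i
      fin_cases i <;> simp [z, y, ← mul_assoc, ← C_mul, algebraMap_eq])

@[simp]
theorem scale_z (a b : ℂˣ) : scale a b z = C (a : ℂ) * z := by
  simp [scale, z]

@[simp]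
theorem scale_y (a b : ℂˣ) : scale a b y = C (b : ℂ) * y := by
  simp [scale, y]

@[simp]
theorem scale_C (a b : ℂˣ) (c : ℂ) : scale a b (C c) = C c :=
  (scale a b).commutes c

/-- Two polynomials that agree up to scaling the coordinates by `ρ`. -/
theorem associated_scale {g G : Poly} {ρ : ℂ} (hρ : ρ ≠ 0)
    (h : scale 1 (Units.mk0 ρ hρ) g = C (ρ ^ 5) * scale (Units.mk0 ρ hρ) 1 G) :
    Associated (((scale 1 (Units.mk0 ρ hρ)).trans (scale (Units.mk0 ρ hρ) 1).symm) g) G := by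
  rw [AlgEquiv.trans_apply, h, map_mul, AlgEquiv.symm_apply_apply]
  have hu : IsUnit (C (ρ ^ 5) : Poly) := (isUnit_iff_ne_zero.2 (pow_ne_zero 5 hρ)).map C
  have : (scale (Units.mk0 ρ hρ) 1).symm (C (ρ ^ 5)) = C (ρ ^ 5) :=
    (scale (Units.mk0 ρ hρ) 1).symm.commutes _
  rw [this]
  exact (associated_isUnit_mul_left_iff hu).2 (Associated.refl G)

theorem exists_finset_card_eq_five {p : ℂ → Prop} {a b : ℂ} (h0 : p 0) (ha : a ≠ 0) (hb : b ≠ 0)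
    (hab : a ≠ b) (h : ∀ d, d ^ 2 = a ∨ d ^ 2 = b → p d) :
    ∃ S : Finset ℂ, S.card = 5 ∧ 0 ∈ S ∧ ∀ d ∈ S, p d := by
  obtain ⟨c, rfl⟩ := IsAlgClosed.exists_pow_nat_eq a (n := 2) (by norm_num)
  obtain ⟨d, rfl⟩ := IsAlgClosed.exists_pow_nat_eq b (n := 2) (by norm_num)
  have hc : c ≠ 0 := by rintro rfl; simp at ha
  have hd : d ≠ 0 := by rintro rfl; simp at hb
  have h1 : c ≠ d := by rintro rfl; exact hab rfl
  have h2 : c ≠ -d := by rintro rfl; exact hab (by ring)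
  have h3 : -c ≠ d := fun h => h2 (by rw [← h, neg_neg])
  have h4 : c ≠ -c := fun h => hc (self_eq_neg.1 h)
  have h5 : d ≠ -d := fun h => hd (self_eq_neg.1 h)
  refine ⟨{0, c, -c, d, -d}, ?_, by simp, ?_⟩
  · rw [Finset.card_insert_of_notMem, Finset.card_insert_of_notMem, Finset.card_insert_of_notMem,
      Finset.card_pair h5] <;>
    simp_all [eq_comm]
  · intro e he
    simp only [Finset.mem_insert, Finset.mem_singleton] at he
    rcases he with rfl | rfl | rfl | rfl | rfl
    · exact h0
    all_goals exact h _ (by simp)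

/-- Allows Bézout cofactors with integer coefficients, the constants being divided out here. -/
theorem separable_of_bezout {k : Type*} [Field k] {f A B : k[X]} {a c : k} (ha : a ≠ 0)
    (hc : c ≠ 0) (h : A * f + B * Polynomial.derivative f = Polynomial.C c) :
    (Polynomial.C a * f).Separable := by
  refine ⟨Polynomial.C (a⁻¹ * c⁻¹) * A, Polynomial.C (a⁻¹ * c⁻¹) * B, ?_⟩
  have h1 : Polynomial.C (a⁻¹ * c⁻¹) * Polynomial.C a * Polynomial.C c = 1 := by
    rw [← Polynomial.C_mul, ← Polynomial.C_mul, ← Polynomial.C_1]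
    congr 1
    field_simp
  rw [Polynomial.derivative_C_mul]
  linear_combination Polynomial.C (a⁻¹ * c⁻¹) * Polynomial.C a * h + h1

theorem monic_and_natDegree_quintic {R : Type*} [CommRing R] [Nontrivial R] {p : R[X]}
    {a b c d e : R} (h : p = Polynomial.X ^ 5 + Polynomial.C a * Polynomial.X ^ 4 +
      Polynomial.C b * Polynomial.X ^ 3 + Polynomial.C c * Polynomial.X ^ 2 +
      Polynomial.C d * Polynomial.X + Polynomial.C e) : p.Monic ∧ p.natDegree = 5 := by
  subst h
  constructor
  · monicity!
  · compute_degree!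

theorem totalDegree_term_le {i j n : ℕ} (c : ℂ) (h : i + j ≤ n) :
    (C c * z ^ i * y ^ j).totalDegree ≤ n := by
  refine (totalDegree_mul _ _).trans
    ((add_le_add ((totalDegree_mul _ _).trans ?_) ?_).trans h)
  · rw [totalDegree_C, zero_add]
    exact (totalDegree_pow _ _).trans (by simp [z])
  · exact (totalDegree_pow _ _).trans (by simp [y])

theorem totalDegree_add_le_of_le {p q : Poly} {n : ℕ} (hp : p.totalDegree ≤ n)
    (hq : q.totalDegree ≤ n) : (p + q).totalDegree ≤ n :=
  (totalDegree_add _ _).trans (max_le hp hq)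

theorem totalDegree_sub_le_of_le {p q : Poly} {n : ℕ} (hp : p.totalDegree ≤ n)
    (hq : q.totalDegree ≤ n) : (p - q).totalDegree ≤ n :=
  (totalDegree_sub _ _).trans (max_le hp hq)

/-- Restricting to `y = 0` bounds the total degree from below by the highest pure power of `z`. -/
theorem natDegree_restrict_le (p : Poly) :
    (aeval ![(Polynomial.X : ℂ[X]), 0] p).natDegree ≤ p.totalDegree := by
  rw [aeval_def, eval₂_eq']
  refine Polynomial.natDegree_sum_le_of_forall_le _ _ fun d hd => ?_
  have hd' := le_totalDegree hd
  rw [Finsupp.sum_fintype _ _ (fun _ => rfl), Fin.sum_univ_two] at hd'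
  rw [Fin.prod_univ_two]
  refine (Polynomial.natDegree_C_mul_le _ _).trans (Polynomial.natDegree_mul_le.trans ?_)
  have h1 := Polynomial.natDegree_X_pow_le (R := ℂ) (d 0)
  have h2 : ((0 : ℂ[X]) ^ d 1).natDegree ≤ 0 :=
    Polynomial.natDegree_pow_le.trans (by simp)
  simp only [Matrix.cons_val_zero, Matrix.cons_val_one]
  omega

/-! ### The first curve -/

/-- The numerator of `z` in the parametrisation `z = w n(x) / r(x)`, `y = w t(x) / r(x) ^ 2`, where
`w ^ 2 = 5/2 x r(x)`, of the rescaled curve. -/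
noncomputable def n₁ : ℂ[X] :=
  1 - 10 * Polynomial.X ^ 2

/-- The common denominator in the parametrisation `z = w n(x) / r(x)`, `y = w t(x) / r(x) ^ 2`, where
`w ^ 2 = 5/2 x r(x)`, of the rescaled curve. -/
noncomputable def r₁ : ℂ[X] :=
  1 - 10 * Polynomial.X - 200 * Polynomial.X ^ 2 - 1100 * Polynomial.X ^ 3
    - 2500 * Polynomial.X ^ 4 - 2000 * Polynomial.X ^ 5

/-- The numerator of `y` in the parametrisation `z = w n(x) / r(x)`, `y = w t(x) / r(x) ^ 2`, where
`w ^ 2 = 5/2 x r(x)`, of the rescaled curve. -/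
noncomputable def t₁ : ℂ[X] :=
  17 + 220 * Polynomial.X + 1890 * Polynomial.X ^ 2 + 14200 * Polynomial.X ^ 3
    + 69500 * Polynomial.X ^ 4 + 192000 * Polynomial.X ^ 5 + 275000 * Polynomial.X ^ 6
    + 160000 * Polynomial.X ^ 7

/-- The right-hand side of the hyperelliptic model `w ^ 2 = f(x)`. -/
noncomputable def f₁ : ℂ[X] := Polynomial.C (5/2) * (Polynomial.X * r₁)

/-- The right-hand side of the model in the chart at infinity. -/
noncomputable def f₁' : ℂ[X] := Polynomial.C (5/2) *
  (-2000 - 2500 * Polynomial.X - 1100 * Polynomial.X ^ 2 - 200 * Polynomial.X ^ 3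
    - 10 * Polynomial.X ^ 4 + Polynomial.X ^ 5)

/-- With `P = w / r` one has `z = P n`, `y = P t / r`, and `e = P ^ 2 r = w ^ 2 / r`. All monomials
of `g` have odd degree, so `g r ^ 7 / P` is a polynomial in `e, n, t, r`, which is the left side
here. -/
theorem parametrization_identity₁ {K : Type*} [Field K] [CharZero K] {x n r t e : K}
    (hn : n = 1 - 10 * x ^ 2)
    (hr : r = 1 - 10 * x - 200 * x ^ 2 - 1100 * x ^ 3 - 2500 * x ^ 4 - 2000 * x ^ 5)
    (ht : t =
      17 + 220 * x + 1890 * x ^ 2 + 14200 * x ^ 3 + 69500 * x ^ 4 + 192000 * x ^ 5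
        + 275000 * x ^ 6 + 160000 * x ^ 7)
    (he : e = 5/2 * x) :
    e ^ 2 * t ^ 5 - 300 * e ^ 3 * n ^ 3 * t ^ 4 - 15 * e ^ 2 * n * t ^ 4 * r
      - 1320 * e ^ 4 * n ^ 6 * t ^ 3 + 3600 * e ^ 3 * n ^ 4 * t ^ 3 * r
      - 145 * e ^ 2 * n ^ 2 * t ^ 3 * r ^ 2 + 35/3 * e * t ^ 3 * r ^ 3
      - 31680 * e ^ 5 * n ^ 9 * t ^ 2 + 11880 * e ^ 4 * n ^ 7 * t ^ 2 * r
      - 15780 * e ^ 3 * n ^ 5 * t ^ 2 * r ^ 2 - 485 * e ^ 2 * n ^ 3 * t ^ 2 * r ^ 3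
      - 190 * e * n * t ^ 2 * r ^ 4 - 69120 * e ^ 6 * n ^ 12 * t
      + 190080 * e ^ 5 * n ^ 10 * t * r - 99000 * e ^ 4 * n ^ 8 * t * r ^ 2
      + 19800 * e ^ 3 * n ^ 6 * t * r ^ 3 + 14250 * e ^ 2 * n ^ 4 * t * r ^ 4
      - 685 * e * n ^ 2 * t * r ^ 5 + 135/4 * t * r ^ 6 - 36864 * e ^ 7 * n ^ 15
      + 207360 * e ^ 6 * n ^ 13 * r - 365760 * e ^ 5 * n ^ 11 * r ^ 2
      + 204600 * e ^ 4 * n ^ 9 * r ^ 3 - 31800 * e ^ 3 * n ^ 7 * r ^ 4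
      - 49546 * e ^ 2 * n ^ 5 * r ^ 5 + 11915/3 * e * n ^ 3 * r ^ 6 - 2295/4 * n * r ^ 7 = 0 := by
  subst hn hr ht he
  ring

/-- The involution `w ↦ -w` fixes `x` and negates `z` and `y`, so numerator and denominator are
taken even; multiplied by `r ^ 5` they become polynomials in `e, n, t, r`. -/
theorem inverse_identity₁ {K : Type*} [Field K] [CharZero K] {x n r t e : K}
    (hn : n = 1 - 10 * x ^ 2)
    (hr : r = 1 - 10 * x - 200 * x ^ 2 - 1100 * x ^ 3 - 2500 * x ^ 4 - 2000 * x ^ 5)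
    (ht : t =
      17 + 220 * x + 1890 * x ^ 2 + 14200 * x ^ 3 + 69500 * x ^ 4 + 192000 * x ^ 5
        + 275000 * x ^ 6 + 160000 * x ^ 7)
    (he : e = 5/2 * x) :
    4608 * e ^ 5 * n ^ 10 + 38016 * e ^ 4 * n ^ 8 * r + 73416 * e ^ 3 * n ^ 6 * r ^ 2
      - 20592 * e ^ 2 * n ^ 4 * r ^ 3 + 1352 * e * n ^ 2 * r ^ 4 - 8064 * e ^ 4 * n ^ 7 * t
      - 33072 * e ^ 3 * n ^ 5 * t * r + 5160 * e ^ 2 * n ^ 3 * t * r ^ 2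
      - 104 * e * n * t * r ^ 3 + 3528 * e ^ 3 * n ^ 4 * t ^ 2 - 168 * e ^ 2 * n ^ 2 * t ^ 2 * r
      + 2 * e * t ^ 2 * r ^ 2 =
      x * (-46080 * e ^ 5 * n ^ 10 + 34560 * e ^ 4 * n ^ 8 * r - 290640 * e ^ 3 * n ^ 6 * r ^ 2
          + 54480 * e ^ 2 * n ^ 4 * r ^ 3 - 16130 * e * n ^ 2 * r ^ 4 + 405 * r ^ 5
          - 23040 * e ^ 4 * n ^ 7 * t + 120480 * e ^ 3 * n ^ 5 * t * r
          - 12900 * e ^ 2 * n ^ 3 * t * r ^ 2 + 1760 * e * n * t * r ^ 3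
          - 15120 * e ^ 3 * n ^ 4 * t ^ 2 - 2280 * e ^ 2 * n ^ 2 * t ^ 2 * r
          + 70 * e * t ^ 2 * r ^ 2 + 300 * e ^ 2 * n * t ^ 3) := by
  subst hn hr ht he
  ring

/-- The numerator of the inverse of the parametrisation. -/
noncomputable def inverseNum₁ : Poly :=
  4608 * z ^ 10 + 38016 * z ^ 8 + 73416 * z ^ 6 - 20592 * z ^ 4 + 1352 * z ^ 2 - 8064 * z ^ 7 * y
    - 33072 * z ^ 5 * y + 5160 * z ^ 3 * y - 104 * z * y + 3528 * z ^ 4 * y ^ 2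
    - 168 * z ^ 2 * y ^ 2 + 2 * y ^ 2

/-- The denominator of the inverse of the parametrisation. -/
noncomputable def inverseDenom₁ : Poly :=
  -46080 * z ^ 10 + 34560 * z ^ 8 - 290640 * z ^ 6 + 54480 * z ^ 4 - 16130 * z ^ 2 + 405
    - 23040 * z ^ 7 * y + 120480 * z ^ 5 * y - 12900 * z ^ 3 * y + 1760 * z * y
    - 15120 * z ^ 4 * y ^ 2 - 2280 * z ^ 2 * y ^ 2 + 70 * y ^ 2 + 300 * z * y ^ 3

theorem aeval_parametrization₁ {K : Type} [Field K] [Algebra ℂ K] {x w : K}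
    (hw : w ^ 2 = Polynomial.aeval x f₁) (hr : Polynomial.aeval x r₁ ≠ 0) :
    aeval ![w * Polynomial.aeval x n₁ / Polynomial.aeval x r₁,
      w * Polynomial.aeval x t₁ / Polynomial.aeval x r₁ ^ 2]
      (g₁ 17) = 0 := by
  have := charZero_of_injective_algebraMap (algebraMap ℂ K).injective
  obtain ⟨n, hn⟩ : ∃ n, n = Polynomial.aeval x n₁ := ⟨_, rfl⟩
  obtain ⟨r, hr'⟩ : ∃ r, r = Polynomial.aeval x r₁ := ⟨_, rfl⟩
  obtain ⟨t, ht⟩ : ∃ t, t = Polynomial.aeval x t₁ := ⟨_, rfl⟩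
  rw [← hr'] at hr
  rw [← hn, ← hr', ← ht]
  simp only [f₁, map_mul, Polynomial.aeval_C, Polynomial.aeval_X, ← hr'] at hw
  have he : (w / r) ^ 2 * r = 5/2 * x := by
    rw [div_pow, hw]
    simp only [map_div₀, map_ofNat]
    field_simp
  simp only [n₁, r₁, t₁, map_add, map_sub, map_mul, map_pow, map_ofNat, map_one,
    Polynomial.aeval_X] at hn hr' ht
  -- Here `e` is `(w / r) ^ 2 * r`.
  have key := parametrization_identity₁ hn hr' ht he
  simp only [g₁, z, y, map_sub, map_add, map_mul, map_pow, aeval_C, aeval_X,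
    Matrix.cons_val_zero, Matrix.cons_val_one, map_div₀, map_ofNat]
  generalize hP : w / r = P at key
  have hZ : w * n / r = P * n := by rw [← hP]; ring
  have hY : w * t / r ^ 2 = P * t / r := by rw [← hP]; field_simp
  rw [hZ, hY]
  refine (mul_eq_zero.1 ?_).resolve_left (pow_ne_zero 7 hr)
  rw [← mul_zero P, ← key]
  field_simp
  ring

theorem aeval_inverse₁ {K : Type} [Field K] [Algebra ℂ K] {x w : K}
    (hw : w ^ 2 = Polynomial.aeval x f₁) (hr : Polynomial.aeval x r₁ ≠ 0) :
    aeval ![w * Polynomial.aeval x n₁ / Polynomial.aeval x r₁,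
      w * Polynomial.aeval x t₁ / Polynomial.aeval x r₁ ^ 2] inverseNum₁ =
      x * aeval ![w * Polynomial.aeval x n₁ / Polynomial.aeval x r₁,
      w * Polynomial.aeval x t₁ / Polynomial.aeval x r₁ ^ 2]
        inverseDenom₁ := by
  have := charZero_of_injective_algebraMap (algebraMap ℂ K).injective
  obtain ⟨n, hn⟩ : ∃ n, n = Polynomial.aeval x n₁ := ⟨_, rfl⟩
  obtain ⟨r, hr'⟩ : ∃ r, r = Polynomial.aeval x r₁ := ⟨_, rfl⟩
  obtain ⟨t, ht⟩ : ∃ t, t = Polynomial.aeval x t₁ := ⟨_, rfl⟩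
  rw [← hr'] at hr
  rw [← hn, ← hr', ← ht]
  simp only [f₁, map_mul, Polynomial.aeval_C, Polynomial.aeval_X, ← hr'] at hw
  have he : (w / r) ^ 2 * r = 5/2 * x := by
    rw [div_pow, hw]
    simp only [map_div₀, map_ofNat]
    field_simp
  simp only [n₁, r₁, t₁, map_add, map_sub, map_mul, map_pow, map_ofNat, map_one,
    Polynomial.aeval_X] at hn hr' ht
  have key := inverse_identity₁ hn hr' ht he
  simp only [inverseNum₁, inverseDenom₁, z, y, map_sub, map_add, map_neg, map_mul, map_pow,
    aeval_X, Matrix.cons_val_zero, Matrix.cons_val_one, map_ofNat]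
  generalize hP : w / r = P at key
  have hZ : w * n / r = P * n := by rw [← hP]; ring
  have hY : w * t / r ^ 2 = P * t / r := by rw [← hP]; field_simp
  rw [hZ, hY]
  refine mul_left_cancel₀ (pow_ne_zero 5 hr) ?_
  calc _ = _ := ?_
    _ = _ := key
    _ = _ := ?_
  · field_simp
  · field_simp

theorem separable_f₁ : f₁.Separable := by
  refine separable_of_bezout (c := 6)
    (A := 230 + 5415 * Polynomial.X + 34800 * Polynomial.X ^ 2 + 93750 * Polynomial.X ^ 3
        + 90000 * Polynomial.X ^ 4)
    (B := 6 - 110 * Polynomial.X - 1715 * Polynomial.X ^ 2 - 8550 * Polynomial.X ^ 3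
        - 18750 * Polynomial.X ^ 4 - 15000 * Polynomial.X ^ 5)
    (by norm_num) (by norm_num) ?_
  simp only [r₁, Polynomial.derivative_sub, Polynomial.derivative_mul,
    Polynomial.derivative_X, Polynomial.derivative_X_pow, Polynomial.derivative_ofNat,
    Polynomial.derivative_one, map_ofNat, map_natCast]
  push_cast
  ring

theorem separable_f₁' : f₁'.Separable := by
  refine separable_of_bezout (c := 600000)
    (A := 97200 + 43050 * Polynomial.X + 4740 * Polynomial.X ^ 2 - 455 * Polynomial.X ^ 3)
    (B := -78000 - 63000 * Polynomial.X - 15450 * Polynomial.X ^ 2 - 1130 * Polynomial.X ^ 3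
        + 91 * Polynomial.X ^ 4)
    (by norm_num) (by norm_num) ?_
  simp only [Polynomial.derivative_add, Polynomial.derivative_sub, Polynomial.derivative_mul,
    Polynomial.derivative_X, Polynomial.derivative_X_pow, Polynomial.derivative_ofNat,
    map_ofNat, Polynomial.derivative_neg, map_natCast]
  push_cast
  ring

/-! ### The second curve -/

/-- The numerator of `z` in the parametrisation `z = w n(x) / r(x)`, `y = w t(x) / r(x) ^ 2`, where
`w ^ 2 = (-15) x r(x)`, of the rescaled curve. -/
noncomputable def n₂ : ℂ[X] :=
  1 + 15 * Polynomial.X ^ 2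

/-- The common denominator in the parametrisation `z = w n(x) / r(x)`, `y = w t(x) / r(x) ^ 2`, where
`w ^ 2 = (-15) x r(x)`, of the rescaled curve. -/
noncomputable def r₂ : ℂ[X] :=
  1 + 15 * Polynomial.X + 1050 * Polynomial.X ^ 2 + 3150 * Polynomial.X ^ 3
    - 16875 * Polynomial.X ^ 4 - 10125 * Polynomial.X ^ 5

/-- The numerator of `y` in the parametrisation `z = w n(x) / r(x)`, `y = w t(x) / r(x) ^ 2`, where
`w ^ 2 = (-15) x r(x)`, of the rescaled curve. -/
noncomputable def t₂ : ℂ[X] :=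
  3 + 255 * Polynomial.X + 1935 * Polynomial.X ^ 2 + 27675 * Polynomial.X ^ 3
    + 203625 * Polynomial.X ^ 4 + 1036125 * Polynomial.X ^ 5 + 253125 * Polynomial.X ^ 6
    + 455625 * Polynomial.X ^ 7

/-- The right-hand side of the hyperelliptic model `w ^ 2 = f(x)`. -/
noncomputable def f₂ : ℂ[X] := Polynomial.C (-15) * (Polynomial.X * r₂)

/-- The right-hand side of the model in the chart at infinity. -/
noncomputable def f₂' : ℂ[X] := Polynomial.C (-15) *
  (-10125 - 16875 * Polynomial.X + 3150 * Polynomial.X ^ 2 + 1050 * Polynomial.X ^ 3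
    + 15 * Polynomial.X ^ 4 + Polynomial.X ^ 5)

/-- The substitution of `parametrization_identity₁`, now with `w ^ 2 / r = -15 x`. -/
theorem parametrization_identity₂ {K : Type*} [Field K] [CharZero K] {x n r t e : K}
    (hn : n = 1 + 15 * x ^ 2)
    (hr : r = 1 + 15 * x + 1050 * x ^ 2 + 3150 * x ^ 3 - 16875 * x ^ 4 - 10125 * x ^ 5)
    (ht : t =
      3 + 255 * x + 1935 * x ^ 2 + 27675 * x ^ 3 + 203625 * x ^ 4 + 1036125 * x ^ 5
        + 253125 * x ^ 6 + 455625 * x ^ 7)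
    (he : e = -15 * x) :
    e ^ 2 * t ^ 5 + 1300/9 * e ^ 3 * n ^ 3 * t ^ 4 - 10 * e ^ 2 * n * t ^ 4 * r
      + 474880/81 * e ^ 4 * n ^ 6 * t ^ 3 - 10400/9 * e ^ 3 * n ^ 4 * t ^ 3 * r
      + 265/3 * e ^ 2 * n ^ 2 * t ^ 3 * r ^ 2 + 5/6 * e * t ^ 3 * r ^ 3
      + 942080/9 * e ^ 5 * n ^ 9 * t ^ 2 - 949760/27 * e ^ 4 * n ^ 7 * t ^ 2 * r
      + 143840/27 * e ^ 3 * n ^ 5 * t ^ 2 * r ^ 2 - 9130/27 * e ^ 2 * n ^ 3 * t ^ 2 * r ^ 3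
      + 35/6 * e * n * t ^ 2 * r ^ 4 + 2621440/3 * e ^ 6 * n ^ 12 * t
      - 3768320/9 * e ^ 5 * n ^ 10 * t * r + 2560000/27 * e ^ 4 * n ^ 8 * t * r ^ 2
      - 313600/27 * e ^ 3 * n ^ 6 * t * r ^ 3 + 7000/9 * e ^ 2 * n ^ 4 * t * r ^ 4
      - 695/18 * e * n ^ 2 * t * r ^ 5 + 10/9 * t * r ^ 6 + 8388608/3 * e ^ 7 * n ^ 15
      - 5242880/3 * e ^ 6 * n ^ 13 * r + 4751360/9 * e ^ 5 * n ^ 11 * r ^ 2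
      - 7577600/81 * e ^ 4 * n ^ 9 * r ^ 3 + 92800/9 * e ^ 3 * n ^ 7 * r ^ 4
      - 2512/3 * e ^ 2 * n ^ 5 * r ^ 5 + 1015/18 * e * n ^ 3 * r ^ 6 - 10/3 * n * r ^ 7 = 0 := by
  subst hn hr ht he
  ring

theorem inverse_identity₂ {K : Type*} [Field K] [CharZero K] {x n r t e : K}
    (hn : n = 1 + 15 * x ^ 2)
    (hr : r = 1 + 15 * x + 1050 * x ^ 2 + 3150 * x ^ 3 - 16875 * x ^ 4 - 10125 * x ^ 5)
    (ht : t =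
      3 + 255 * x + 1935 * x ^ 2 + 27675 * x ^ 3 + 203625 * x ^ 4 + 1036125 * x ^ 5
        + 253125 * x ^ 6 + 455625 * x ^ 7)
    (he : e = -15 * x) :
    589824 * e ^ 5 * n ^ 10 - 319488 * e ^ 4 * n ^ 8 * r + 68608 * e ^ 3 * n ^ 6 * r ^ 2
      - 9504 * e ^ 2 * n ^ 4 * r ^ 3 + 651 * e * n ^ 2 * r ^ 4 + 135168 * e ^ 4 * n ^ 7 * t
      - 49664 * e ^ 3 * n ^ 5 * t * r + 6480 * e ^ 2 * n ^ 3 * t * r ^ 2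
      - 468 * e * n * t * r ^ 3 + 10464 * e ^ 3 * n ^ 4 * t ^ 2
      - 1926 * e ^ 2 * n ^ 2 * t ^ 2 * r + 81 * e * t ^ 2 * r ^ 2 + 270 * e ^ 2 * n * t ^ 3 =
      x * (8847360 * e ^ 5 * n ^ 10 - 2580480 * e ^ 4 * n ^ 8 * r + 430080 * e ^ 3 * n ^ 6 * r ^ 2
          - 1440 * e ^ 2 * n ^ 4 * r ^ 3 - 3015 * e * n ^ 2 * r ^ 4 + 360 * r ^ 5
          + 1658880 * e ^ 4 * n ^ 7 * t - 253440 * e ^ 3 * n ^ 5 * t * r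
          + 22800 * e ^ 2 * n ^ 3 * t * r ^ 2 + 2520 * e * n * t * r ^ 3
          + 92640 * e ^ 3 * n ^ 4 * t ^ 2 - 3510 * e ^ 2 * n ^ 2 * t ^ 2 * r
          + 135 * e * t ^ 2 * r ^ 2 + 1350 * e ^ 2 * n * t ^ 3) := by
  subst hn hr ht he
  ring

/-- The numerator of the inverse of the parametrisation. -/
noncomputable def inverseNum₂ : Poly :=
  589824 * z ^ 10 - 319488 * z ^ 8 + 68608 * z ^ 6 - 9504 * z ^ 4 + 651 * z ^ 2
    + 135168 * z ^ 7 * y - 49664 * z ^ 5 * y + 6480 * z ^ 3 * y - 468 * z * y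
    + 10464 * z ^ 4 * y ^ 2 - 1926 * z ^ 2 * y ^ 2 + 81 * y ^ 2 + 270 * z * y ^ 3

/-- The denominator of the inverse of the parametrisation. -/
noncomputable def inverseDenom₂ : Poly :=
  8847360 * z ^ 10 - 2580480 * z ^ 8 + 430080 * z ^ 6 - 1440 * z ^ 4 - 3015 * z ^ 2 + 360
    + 1658880 * z ^ 7 * y - 253440 * z ^ 5 * y + 22800 * z ^ 3 * y + 2520 * z * y
    + 92640 * z ^ 4 * y ^ 2 - 3510 * z ^ 2 * y ^ 2 + 135 * y ^ 2 + 1350 * z * y ^ 3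

theorem aeval_parametrization₂ {K : Type} [Field K] [Algebra ℂ K] {x w : K}
    (hw : w ^ 2 = Polynomial.aeval x f₂) (hr : Polynomial.aeval x r₂ ≠ 0) :
    aeval ![w * Polynomial.aeval x n₂ / Polynomial.aeval x r₂,
      w * Polynomial.aeval x t₂ / Polynomial.aeval x r₂ ^ 2]
      (g₂ 3) = 0 := by
  have := charZero_of_injective_algebraMap (algebraMap ℂ K).injective
  obtain ⟨n, hn⟩ : ∃ n, n = Polynomial.aeval x n₂ := ⟨_, rfl⟩
  obtain ⟨r, hr'⟩ : ∃ r, r = Polynomial.aeval x r₂ := ⟨_, rfl⟩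
  obtain ⟨t, ht⟩ : ∃ t, t = Polynomial.aeval x t₂ := ⟨_, rfl⟩
  rw [← hr'] at hr
  rw [← hn, ← hr', ← ht]
  simp only [f₂, map_mul, Polynomial.aeval_C, Polynomial.aeval_X, ← hr'] at hw
  have he : (w / r) ^ 2 * r = -15 * x := by
    rw [div_pow, hw]
    simp only [map_neg, map_ofNat]
    field_simp
  simp only [n₂, r₂, t₂, map_add, map_sub, map_mul, map_pow, map_ofNat, map_one,
    Polynomial.aeval_X] at hn hr' ht
  have key := parametrization_identity₂ hn hr' ht he
  simp only [g₂, z, y, map_sub, map_add, map_mul, map_pow, aeval_C, aeval_X,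
    Matrix.cons_val_zero, Matrix.cons_val_one, map_div₀, map_ofNat]
  generalize hP : w / r = P at key
  have hZ : w * n / r = P * n := by rw [← hP]; ring
  have hY : w * t / r ^ 2 = P * t / r := by rw [← hP]; field_simp
  rw [hZ, hY]
  refine (mul_eq_zero.1 ?_).resolve_left (pow_ne_zero 7 hr)
  rw [← mul_zero P, ← key]
  field_simp
  ring

theorem aeval_inverse₂ {K : Type} [Field K] [Algebra ℂ K] {x w : K}
    (hw : w ^ 2 = Polynomial.aeval x f₂) (hr : Polynomial.aeval x r₂ ≠ 0) :
    aeval ![w * Polynomial.aeval x n₂ / Polynomial.aeval x r₂,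
      w * Polynomial.aeval x t₂ / Polynomial.aeval x r₂ ^ 2] inverseNum₂ =
      x * aeval ![w * Polynomial.aeval x n₂ / Polynomial.aeval x r₂,
      w * Polynomial.aeval x t₂ / Polynomial.aeval x r₂ ^ 2]
        inverseDenom₂ := by
  have := charZero_of_injective_algebraMap (algebraMap ℂ K).injective
  obtain ⟨n, hn⟩ : ∃ n, n = Polynomial.aeval x n₂ := ⟨_, rfl⟩
  obtain ⟨r, hr'⟩ : ∃ r, r = Polynomial.aeval x r₂ := ⟨_, rfl⟩
  obtain ⟨t, ht⟩ : ∃ t, t = Polynomial.aeval x t₂ := ⟨_, rfl⟩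
  rw [← hr'] at hr
  rw [← hn, ← hr', ← ht]
  simp only [f₂, map_mul, Polynomial.aeval_C, Polynomial.aeval_X, ← hr'] at hw
  have he : (w / r) ^ 2 * r = -15 * x := by
    rw [div_pow, hw]
    simp only [map_neg, map_ofNat]
    field_simp
  simp only [n₂, r₂, t₂, map_add, map_sub, map_mul, map_pow, map_ofNat, map_one,
    Polynomial.aeval_X] at hn hr' ht
  have key := inverse_identity₂ hn hr' ht he
  simp only [inverseNum₂, inverseDenom₂, z, y, map_sub, map_add, map_mul, map_pow,
    aeval_X, Matrix.cons_val_zero, Matrix.cons_val_one, map_ofNat]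
  generalize hP : w / r = P at key
  have hZ : w * n / r = P * n := by rw [← hP]; ring
  have hY : w * t / r ^ 2 = P * t / r := by rw [← hP]; field_simp
  rw [hZ, hY]
  refine mul_left_cancel₀ (pow_ne_zero 5 hr) ?_
  calc _ = _ := ?_
    _ = _ := key
    _ = _ := ?_
  · field_simp
  · field_simp

theorem separable_f₂ : f₂.Separable := by
  refine separable_of_bezout (c := 4096)
    (A := -231195 - 18953685 * Polynomial.X - 71907075 * Polynomial.X ^ 2
        + 496378125 * Polynomial.X ^ 3 + 356298750 * Polynomial.X ^ 4)
    (B := 4096 + 108315 * Polynomial.X + 6269760 * Polynomial.X ^ 2 + 18072450 * Polynomial.X ^ 3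
        - 99225000 * Polynomial.X ^ 4 - 59383125 * Polynomial.X ^ 5)
    (by norm_num) (by norm_num) ?_
  simp only [r₂, Polynomial.derivative_add, Polynomial.derivative_sub, Polynomial.derivative_mul,
    Polynomial.derivative_X, Polynomial.derivative_X_pow, Polynomial.derivative_ofNat,
    Polynomial.derivative_one, map_ofNat, map_natCast]
  push_cast
  ring

theorem separable_f₂' : f₂'.Separable := by
  refine separable_of_bezout (c := 9331200000)
    (A := -195975 - 116775 * Polynomial.X - 2145 * Polynomial.X ^ 2 - 185 * Polynomial.X ^ 3)
    (B := -435375 + 103500 * Polynomial.X + 38850 * Polynomial.X ^ 2 + 540 * Polynomial.X ^ 3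
        + 37 * Polynomial.X ^ 4)
    (by norm_num) (by norm_num) ?_
  simp only [Polynomial.derivative_add, Polynomial.derivative_sub, Polynomial.derivative_mul,
    Polynomial.derivative_X, Polynomial.derivative_X_pow, Polynomial.derivative_ofNat,
    map_ofNat, Polynomial.derivative_neg, map_natCast]
  push_cast
  ring

/-! ### The first curve: points with `z = 0`, invariance, degree and genus. -/

theorem monic_toBivariate₁ : (toBivariate (g₁ 17)).Monic ∧
    (toBivariate (g₁ 17)).natDegree = 5 := by
  refine monic_and_natDegree_quintic
    (a := -Polynomial.C (300 / 289 * 17 ^ 2) * Polynomial.X ^ 3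
        - Polynomial.C (15 / 17 * 17) * Polynomial.X)
    (b := -Polynomial.C (1320 / 83521 * 17 ^ 4) * Polynomial.X ^ 6
        + Polynomial.C (3600 / 4913 * 17 ^ 3) * Polynomial.X ^ 4
        - Polynomial.C (145 / 289 * 17 ^ 2) * Polynomial.X ^ 2 + Polynomial.C (35 / 51 * 17))
    (c := -Polynomial.C (31680 / 24137569 * 17 ^ 6) * Polynomial.X ^ 9
        + Polynomial.C (11880 / 1419857 * 17 ^ 5) * Polynomial.X ^ 7
        - Polynomial.C (15780 / 83521 * 17 ^ 4) * Polynomial.X ^ 5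
        - Polynomial.C (485 / 4913 * 17 ^ 3) * Polynomial.X ^ 3
        - Polynomial.C (190 / 289 * 17 ^ 2) * Polynomial.X)
    (d := -Polynomial.C (69120 / 6975757441 * 17 ^ 8) * Polynomial.X ^ 12
        + Polynomial.C (190080 / 410338673 * 17 ^ 7) * Polynomial.X ^ 10
        - Polynomial.C (99000 / 24137569 * 17 ^ 6) * Polynomial.X ^ 8
        + Polynomial.C (19800 / 1419857 * 17 ^ 5) * Polynomial.X ^ 6
        + Polynomial.C (14250 / 83521 * 17 ^ 4) * Polynomial.X ^ 4
        - Polynomial.C (685 / 4913 * 17 ^ 3) * Polynomial.X ^ 2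
        + Polynomial.C (135 / 1156 * 17 ^ 2))
    (e := -Polynomial.C (36864 / 2015993900449 * 17 ^ 10) * Polynomial.X ^ 15
        + Polynomial.C (207360 / 118587876497 * 17 ^ 9) * Polynomial.X ^ 13
        - Polynomial.C (365760 / 6975757441 * 17 ^ 8) * Polynomial.X ^ 11
        + Polynomial.C (204600 / 410338673 * 17 ^ 7) * Polynomial.X ^ 9
        - Polynomial.C (31800 / 24137569 * 17 ^ 6) * Polynomial.X ^ 7
        - Polynomial.C (49546 / 1419857 * 17 ^ 5) * Polynomial.X ^ 5
        + Polynomial.C (11915 / 250563 * 17 ^ 4) * Polynomial.X ^ 3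
        - Polynomial.C (135 / 1156 * 17 ^ 3) * Polynomial.X) ?_
  simp only [toBivariate, g₁, z, y, map_add, map_sub, map_mul, map_pow, map_neg,
    Polynomial.Bivariate.equivMvPolynomial_symm_X_0,
    Polynomial.Bivariate.equivMvPolynomial_symm_X_1,
    Polynomial.Bivariate.equivMvPolynomial_symm_C]
  ring

/-- At a root `u` of `n` one has `z = 0`. Modulo `u ^ 2 = 1/10` the values of `r` and `t` become
linear in `u`, and `y ^ 2 = (5/2) u t ^ 2 / r ^ 3 = -35/6 - (5/3) u`. -/
theorem exists_point₁ {u d : ℂ} (hu : u ^ 2 = 1/10) (hd : d ^ 2 = -35/6 - 5/3 * u) :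
    ∃ u₀ w₀ : ℂ, w₀ ^ 2 = f₁.eval u₀ ∧ r₁.eval u₀ ≠ 0 ∧
      w₀ * n₁.eval u₀ / r₁.eval u₀ = 0 ∧ w₀ * t₁.eval u₀ / r₁.eval u₀ ^ 2 = d := by
  have hr : r₁.eval u = -44 - 140 * u := by
    simp only [r₁, Polynomial.eval_sub, Polynomial.eval_mul,
      Polynomial.eval_pow, Polynomial.eval_X, Polynomial.eval_ofNat, Polynomial.eval_one]
    linear_combination (-450 - 1300 * u - 2500 * u ^ 2 - 2000 * u ^ 3) * hu
  have ht : t₁.eval u = 1176 + 3720 * u := by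
    simp only [t₁, Polynomial.eval_add, Polynomial.eval_mul,
      Polynomial.eval_pow, Polynomial.eval_X, Polynomial.eval_ofNat]
    linear_combination (11590 + 35000 * u + 97000 * u ^ 2 + 208000 * u ^ 3 + 275000 * u ^ 4 + 160000 * u ^ 5) * hu
  have hn : n₁.eval u = 0 := by
    simp only [n₁, Polynomial.eval_sub, Polynomial.eval_mul,
      Polynomial.eval_pow, Polynomial.eval_X, Polynomial.eval_ofNat, Polynomial.eval_one]
    linear_combination (-10) * hu
  -- Multiplying by the conjugate under `u ↦ -u` gives a nonzero norm.
  have hr0 : -44 - 140 * u ≠ 0 := fun h => by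
    have : (-24 : ℂ) = 0 := by
      linear_combination (-44 + 140 * u) * h + (19600) * hu
    norm_num at this
  have ht0 : 1176 + 3720 * u ≠ 0 := fun h => by
    have : (-864 : ℂ) = 0 := by
      linear_combination (1176 - 3720 * u) * h + (13838400) * hu
    norm_num at this
  refine ⟨u, d * (-44 - 140 * u) ^ 2 / (1176 + 3720 * u), ?_, hr ▸ hr0, by rw [hn]; simp, ?_⟩
  · rw [f₁, Polynomial.eval_mul, Polynomial.eval_C, Polynomial.eval_mul, Polynomial.eval_X, hr,
      div_pow, div_eq_iff (pow_ne_zero 2 ht0)]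
    linear_combination (-44 - 140 * u) ^ 4 * hd + (-44 - 140 * u) * (-14907200/3 - 42832000/3 * u + 13720000/3 * u ^ 2) * hu
  · have key : ∀ R T : ℂ, R ≠ 0 → T ≠ 0 → d * R ^ 2 / T * T / R ^ 2 = d := fun R T hR hT => by
      field_simp
    rw [hr, ht]
    exact key _ _ hr0 ht0

/-- These are the roots of `y (y ^ 4 + 35/3 y ^ 2 + 135/4)`, the restriction of `g₁ 17` to `z = 0`:
zero comes from the branch point `x = 0`, the others from the two roots of `n` with both signs of
`w`. -/
theorem exists_points₁ : ∃ S : Finset ℂ, S.card = 5 ∧ 0 ∈ S ∧ ∀ d ∈ S,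
    ∃ u₀ w₀ : ℂ, w₀ ^ 2 = f₁.eval u₀ ∧ r₁.eval u₀ ≠ 0 ∧
      w₀ * n₁.eval u₀ / r₁.eval u₀ = 0 ∧ w₀ * t₁.eval u₀ / r₁.eval u₀ ^ 2 = d := by
  obtain ⟨u, hu⟩ := IsAlgClosed.exists_pow_nat_eq (1/10 : ℂ) (n := 2) (by norm_num)
  have hu0 : u ≠ 0 := by rintro rfl; norm_num at hu
  refine exists_finset_card_eq_five (a := -35/6 - 5/3 * u) (b := -35/6 + 5/3 * u)
    ⟨0, 0, by simp [f₁], by simp [r₁], by simp, by simp⟩ ?_ ?_ ?_ ?_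
  · intro h
    have : (135/4 : ℂ) = 0 := by linear_combination (-35/6 + 5/3 * u) * h + (25/9) * hu
    norm_num at this
  · intro h
    have : (135/4 : ℂ) = 0 := by linear_combination (-35/6 - 5/3 * u) * h + (25/9) * hu
    norm_num at this
  · intro h
    exact hu0 (by linear_combination (-3/10) * h)
  · rintro d (hd | hd)
    · exact exists_point₁ hu hd
    · exact exists_point₁ (u := -u) (by rw [neg_sq, hu]) (by rw [hd]; ring)

theorem isInvariantWithCofactor₁ (q : ℂ) :
    IsInvariantWithCofactor P (Q₁ q) (g₁ q) (15 * y) := by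
  rw [IsInvariantWithCofactor]
  have hz : pderiv (0 : Fin 2) z = 1 := pderiv_X_self 0
  have hy : pderiv (1 : Fin 2) y = 1 := pderiv_X_self 1
  have hz' : pderiv (1 : Fin 2) z = 0 := pderiv_X_of_ne (by decide)
  have hy' : pderiv (0 : Fin 2) y = 0 := pderiv_X_of_ne (by decide)
  simp only [P, Q₁, g₁, map_add, map_sub, Derivation.leibniz, Derivation.leibniz_pow, pderiv_C,
    hz, hy, hz', hy', smul_eq_mul, nsmul_eq_mul, mul_zero, zero_add, add_zero, mul_one]
  -- Evaluation turns the constants `C (...)` into scalars, so that `ring` sees the powers of `q`.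
  refine MvPolynomial.funext fun v => ?_
  simp only [map_add, map_sub, map_mul, map_pow, map_ofNat, map_natCast, map_one, map_zero, eval_C]
  push_cast
  ring

theorem totalDegree_g₁ {q : ℂ} (hq : q ≠ 0) : (g₁ q).totalDegree = 15 := by
  apply le_antisymm
  -- Zero exponents are written out so that `totalDegree_term_le` fits every term.
  · have h : g₁ q =
        C (1) * z ^ 0 * y ^ 5 + C (3600 / 4913 * q ^ 3) * z ^ 4 * y ^ 3
          + C (35 / 51 * q) * z ^ 0 * y ^ 3 + C (11880 / 1419857 * q ^ 5) * z ^ 7 * y ^ 2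
          + C (190080 / 410338673 * q ^ 7) * z ^ 10 * y ^ 1
          + C (19800 / 1419857 * q ^ 5) * z ^ 6 * y ^ 1
          + C (14250 / 83521 * q ^ 4) * z ^ 4 * y ^ 1 + C (135 / 1156 * q ^ 2) * z ^ 0 * y ^ 1
          + C (207360 / 118587876497 * q ^ 9) * z ^ 13 * y ^ 0
          + C (204600 / 410338673 * q ^ 7) * z ^ 9 * y ^ 0
          + C (11915 / 250563 * q ^ 4) * z ^ 3 * y ^ 0 - C (300 / 289 * q ^ 2) * z ^ 3 * y ^ 4
          - C (15 / 17 * q) * z ^ 1 * y ^ 4 - C (1320 / 83521 * q ^ 4) * z ^ 6 * y ^ 3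
          - C (145 / 289 * q ^ 2) * z ^ 2 * y ^ 3 - C (31680 / 24137569 * q ^ 6) * z ^ 9 * y ^ 2
          - C (15780 / 83521 * q ^ 4) * z ^ 5 * y ^ 2 - C (485 / 4913 * q ^ 3) * z ^ 3 * y ^ 2
          - C (190 / 289 * q ^ 2) * z ^ 1 * y ^ 2
          - C (69120 / 6975757441 * q ^ 8) * z ^ 12 * y ^ 1
          - C (99000 / 24137569 * q ^ 6) * z ^ 8 * y ^ 1 - C (685 / 4913 * q ^ 3) * z ^ 2 * y ^ 1
          - C (36864 / 2015993900449 * q ^ 10) * z ^ 15 * y ^ 0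
          - C (365760 / 6975757441 * q ^ 8) * z ^ 11 * y ^ 0
          - C (31800 / 24137569 * q ^ 6) * z ^ 7 * y ^ 0
          - C (49546 / 1419857 * q ^ 5) * z ^ 5 * y ^ 0 - C (135 / 1156 * q ^ 3) * z ^ 1 * y ^ 0 := by
      simp only [g₁, C_1]
      ring
    rw [h]
    repeat' with_reducible first
      | refine totalDegree_sub_le_of_le ?_ ?_
      | refine totalDegree_add_le_of_le ?_ ?_
      | exact totalDegree_term_le _ (by norm_num)
  · refine le_trans ?_ (natDegree_restrict_le _)
    apply Polynomial.le_natDegree_of_ne_zero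
    simp only [g₁, z, y, map_add, map_sub, map_mul (aeval _), map_pow (aeval _), aeval_C, aeval_X,
      Matrix.cons_val_zero, Matrix.cons_val_one, Polynomial.algebraMap_apply, Algebra.algebraMap_self,
      RingHom.id_apply, ne_eq, OfNat.ofNat_ne_zero, not_false_eq_true, zero_pow, mul_zero, zero_mul,
      add_zero, sub_zero, zero_sub, Polynomial.coeff_add, Polynomial.coeff_sub,
      Polynomial.coeff_neg, Polynomial.coeff_C_mul, Polynomial.coeff_X_pow, Polynomial.coeff_X]
    simp [hq]

theorem exists_curveGenus_g₁_eq_two {q : ℂ} (hq : q ≠ 0) :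
    ∃ h : Irreducible (g₁ q), curveGenus (g₁ q) h = 2 := by
  -- The parameter has weight 2, so scaling it to 17 needs a square root.
  obtain ⟨ρ, hρ⟩ := IsAlgClosed.exists_pow_nat_eq (q / 17) (n := 2) (by norm_num)
  have hρ0 : ρ ≠ 0 := by
    rintro rfl
    exact hq (by linear_combination (-17) * hρ)
  have hq' : q = 17 * ρ ^ 2 := by rw [hρ]; ring
  obtain ⟨S, hS, h0S, hpt⟩ := exists_points₁
  have hscale : scale 1 (Units.mk0 ρ hρ0) (g₁ q) =
      C (ρ ^ 5) * scale (Units.mk0 ρ hρ0) 1 (g₁ 17) := by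
    rw [hq']
    simp only [g₁, map_add, map_sub, map_mul (scale _ _), map_pow (scale _ _), scale_z, scale_y,
      scale_C]
    refine MvPolynomial.funext fun v => ?_
    simp only [map_add, map_sub, map_mul (eval v), map_pow (eval v), eval_C, Units.val_mk0,
      Units.val_one]
    ring
  refine exists_curveGenus_eq_two _ (associated_scale hρ0 hscale) monic_toBivariate₁.1
    monic_toBivariate₁.2 separable_f₁ ?_ separable_f₁' ?_ ?_ ?_ aeval_parametrization₁
    aeval_inverse₁ ?_ hS h0S hpt
  · intro a b h
    refine eq_zero_of_sq_eq_of_X_mul (s := Polynomial.C (5/2) * r₁) ?_ (h.trans ?_)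
    · simp [r₁]
    · rw [f₁]; ring
  · intro a b h
    refine eq_zero_of_sq_eq_of_odd_natDegree ?_ h
    have : f₁'.natDegree = 5 := by
      rw [f₁']
      compute_degree!
    rw [this]
    decide
  · intro K _ _ x hx
    simp only [f₁, f₁', r₁, map_mul, map_sub, map_add, map_neg, map_pow, Polynomial.aeval_C,
      Polynomial.aeval_X, map_ofNat, map_one]
    field_simp
    ring
  · intro h
    have := congrArg (Polynomial.eval 0) h
    simp [n₁] at this
  · simp [inverseDenom₁, z, y]

/-! ### The second curve: points with `z = 0`, invariance, degree and genus. -/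

theorem monic_toBivariate₂ : (toBivariate (g₂ 3)).Monic ∧
    (toBivariate (g₂ 3)).natDegree = 5 := by
  refine monic_and_natDegree_quintic
    (a := Polynomial.C (1300 / 81 * 3 ^ 2) * Polynomial.X ^ 3
        - Polynomial.C (10 / 3 * 3) * Polynomial.X)
    (b := Polynomial.C (474880 / 6561 * 3 ^ 4) * Polynomial.X ^ 6
        - Polynomial.C (10400 / 243 * 3 ^ 3) * Polynomial.X ^ 4
        + Polynomial.C (265 / 27 * 3 ^ 2) * Polynomial.X ^ 2 + Polynomial.C (5 / 18 * 3))
    (c := Polynomial.C (942080 / 6561 * 3 ^ 6) * Polynomial.X ^ 9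
        - Polynomial.C (949760 / 6561 * 3 ^ 5) * Polynomial.X ^ 7
        + Polynomial.C (143840 / 2187 * 3 ^ 4) * Polynomial.X ^ 5
        - Polynomial.C (9130 / 729 * 3 ^ 3) * Polynomial.X ^ 3
        + Polynomial.C (35 / 54 * 3 ^ 2) * Polynomial.X)
    (d := Polynomial.C (2621440 / 19683 * 3 ^ 8) * Polynomial.X ^ 12
        - Polynomial.C (3768320 / 19683 * 3 ^ 7) * Polynomial.X ^ 10
        + Polynomial.C (2560000 / 19683 * 3 ^ 6) * Polynomial.X ^ 8
        - Polynomial.C (313600 / 6561 * 3 ^ 5) * Polynomial.X ^ 6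
        + Polynomial.C (7000 / 729 * 3 ^ 4) * Polynomial.X ^ 4
        - Polynomial.C (695 / 486 * 3 ^ 3) * Polynomial.X ^ 2 + Polynomial.C (10 / 81 * 3 ^ 2))
    (e := Polynomial.C (8388608 / 177147 * 3 ^ 10) * Polynomial.X ^ 15
        - Polynomial.C (5242880 / 59049 * 3 ^ 9) * Polynomial.X ^ 13
        + Polynomial.C (4751360 / 59049 * 3 ^ 8) * Polynomial.X ^ 11
        - Polynomial.C (7577600 / 177147 * 3 ^ 7) * Polynomial.X ^ 9
        + Polynomial.C (92800 / 6561 * 3 ^ 6) * Polynomial.X ^ 7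
        - Polynomial.C (2512 / 729 * 3 ^ 5) * Polynomial.X ^ 5
        + Polynomial.C (1015 / 1458 * 3 ^ 4) * Polynomial.X ^ 3
        - Polynomial.C (10 / 81 * 3 ^ 3) * Polynomial.X) ?_
  simp only [toBivariate, g₂, z, y, map_add, map_sub, map_mul, map_pow,
    Polynomial.Bivariate.equivMvPolynomial_symm_X_0,
    Polynomial.Bivariate.equivMvPolynomial_symm_X_1,
    Polynomial.Bivariate.equivMvPolynomial_symm_C]
  ring

/-- As for the first curve, with `y ^ 2 = -15 u t ^ 2 / r ^ 3` reduced modulo `u ^ 2 = -1/15`. -/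
theorem exists_point₂ {u d : ℂ} (hu : u ^ 2 = -1/15) (hd : d ^ 2 = -5/12 + 15/4 * u) :
    ∃ u₀ w₀ : ℂ, w₀ ^ 2 = f₂.eval u₀ ∧ r₂.eval u₀ ≠ 0 ∧
      w₀ * n₂.eval u₀ / r₂.eval u₀ = 0 ∧ w₀ * t₂.eval u₀ / r₂.eval u₀ ^ 2 = d := by
  have hr : r₂.eval u = -144 - 240 * u := by
    simp only [r₂, Polynomial.eval_add, Polynomial.eval_sub, Polynomial.eval_mul,
      Polynomial.eval_pow, Polynomial.eval_X, Polynomial.eval_ofNat, Polynomial.eval_one]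
    linear_combination (2175 + 3825 * u - 16875 * u ^ 2 - 10125 * u ^ 3) * hu
  have ht : t₂.eval u = 704 + 2880 * u := by
    simp only [t₂, Polynomial.eval_add, Polynomial.eval_mul,
      Polynomial.eval_pow, Polynomial.eval_X, Polynomial.eval_ofNat]
    linear_combination (-10515 - 39375 * u + 186750 * u ^ 2 + 1005750 * u ^ 3 + 253125 * u ^ 4 + 455625 * u ^ 5) * hu
  have hn : n₂.eval u = 0 := by
    simp only [n₂, Polynomial.eval_add, Polynomial.eval_mul,
      Polynomial.eval_pow, Polynomial.eval_X, Polynomial.eval_ofNat, Polynomial.eval_one]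
    linear_combination (15) * hu
  have hr0 : -144 - 240 * u ≠ 0 := fun h => by
    have : (24576 : ℂ) = 0 := by
      linear_combination (-144 + 240 * u) * h + (57600) * hu
    norm_num at this
  have ht0 : 704 + 2880 * u ≠ 0 := fun h => by
    have : (1048576 : ℂ) = 0 := by
      linear_combination (704 - 2880 * u) * h + (8294400) * hu
    norm_num at this
  refine ⟨u, d * (-144 - 240 * u) ^ 2 / (704 + 2880 * u), ?_, hr ▸ hr0, by rw [hn]; simp, ?_⟩
  · rw [f₂, Polynomial.eval_mul, Polynomial.eval_C, Polynomial.eval_mul, Polynomial.eval_X, hr,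
      div_pow, div_eq_iff (pow_ne_zero 2 ht0)]
    linear_combination (-144 - 240 * u) ^ 4 * hd + (-144 - 240 * u) * (18662400 + 36864000 * u - 51840000 * u ^ 2) * hu
  · have key : ∀ R T : ℂ, R ≠ 0 → T ≠ 0 → d * R ^ 2 / T * T / R ^ 2 = d := fun R T hR hT => by
      field_simp
    rw [hr, ht]
    exact key _ _ hr0 ht0

/-- The roots of `y (y ^ 4 + 5/6 y ^ 2 + 10/9)`, the restriction of `g₂ 3` to `z = 0`. -/
theorem exists_points₂ : ∃ S : Finset ℂ, S.card = 5 ∧ 0 ∈ S ∧ ∀ d ∈ S,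
    ∃ u₀ w₀ : ℂ, w₀ ^ 2 = f₂.eval u₀ ∧ r₂.eval u₀ ≠ 0 ∧
      w₀ * n₂.eval u₀ / r₂.eval u₀ = 0 ∧ w₀ * t₂.eval u₀ / r₂.eval u₀ ^ 2 = d := by
  obtain ⟨u, hu⟩ := IsAlgClosed.exists_pow_nat_eq (-1/15 : ℂ) (n := 2) (by norm_num)
  have hu0 : u ≠ 0 := by rintro rfl; norm_num at hu
  refine exists_finset_card_eq_five (a := -5/12 + 15/4 * u) (b := -5/12 - 15/4 * u)
    ⟨0, 0, by simp [f₂], by simp [r₂], by simp, by simp⟩ ?_ ?_ ?_ ?_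
  · intro h
    have : (10/9 : ℂ) = 0 := by linear_combination (-5/12 - 15/4 * u) * h + (225/16) * hu
    norm_num at this
  · intro h
    have : (10/9 : ℂ) = 0 := by linear_combination (-5/12 + 15/4 * u) * h + (225/16) * hu
    norm_num at this
  · intro h
    exact hu0 (by linear_combination (2/15) * h)
  · rintro d (hd | hd)
    · exact exists_point₂ hu hd
    · exact exists_point₂ (u := -u) (by rw [neg_sq, hu]) (by rw [hd]; ring)

theorem isInvariantWithCofactor₂ (p : ℂ) :
    IsInvariantWithCofactor P (Q₂ p) (g₂ p) (15 * y) := by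
  rw [IsInvariantWithCofactor]
  have hz : pderiv (0 : Fin 2) z = 1 := pderiv_X_self 0
  have hy : pderiv (1 : Fin 2) y = 1 := pderiv_X_self 1
  have hz' : pderiv (1 : Fin 2) z = 0 := pderiv_X_of_ne (by decide)
  have hy' : pderiv (0 : Fin 2) y = 0 := pderiv_X_of_ne (by decide)
  simp only [P, Q₂, g₂, map_add, map_sub, Derivation.leibniz, Derivation.leibniz_pow, pderiv_C,
    hz, hy, hz', hy', smul_eq_mul, nsmul_eq_mul, mul_zero, zero_add, add_zero, mul_one]
  refine MvPolynomial.funext fun v => ?_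
  simp only [map_add, map_sub, map_mul, map_pow, map_ofNat, map_natCast, map_one, map_zero, eval_C]
  push_cast
  ring

theorem totalDegree_g₂ {p : ℂ} (hp : p ≠ 0) : (g₂ p).totalDegree = 15 := by
  apply le_antisymm
  · have h : g₂ p =
        C (1) * z ^ 0 * y ^ 5 + C (1300 / 81 * p ^ 2) * z ^ 3 * y ^ 4
          + C (474880 / 6561 * p ^ 4) * z ^ 6 * y ^ 3 + C (265 / 27 * p ^ 2) * z ^ 2 * y ^ 3
          + C (5 / 18 * p) * z ^ 0 * y ^ 3 + C (942080 / 6561 * p ^ 6) * z ^ 9 * y ^ 2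
          + C (143840 / 2187 * p ^ 4) * z ^ 5 * y ^ 2 + C (35 / 54 * p ^ 2) * z ^ 1 * y ^ 2
          + C (2621440 / 19683 * p ^ 8) * z ^ 12 * y ^ 1
          + C (2560000 / 19683 * p ^ 6) * z ^ 8 * y ^ 1 + C (7000 / 729 * p ^ 4) * z ^ 4 * y ^ 1
          + C (10 / 81 * p ^ 2) * z ^ 0 * y ^ 1 + C (8388608 / 177147 * p ^ 10) * z ^ 15 * y ^ 0
          + C (4751360 / 59049 * p ^ 8) * z ^ 11 * y ^ 0
          + C (92800 / 6561 * p ^ 6) * z ^ 7 * y ^ 0 + C (1015 / 1458 * p ^ 4) * z ^ 3 * y ^ 0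
          - C (10 / 3 * p) * z ^ 1 * y ^ 4 - C (10400 / 243 * p ^ 3) * z ^ 4 * y ^ 3
          - C (949760 / 6561 * p ^ 5) * z ^ 7 * y ^ 2 - C (9130 / 729 * p ^ 3) * z ^ 3 * y ^ 2
          - C (3768320 / 19683 * p ^ 7) * z ^ 10 * y ^ 1
          - C (313600 / 6561 * p ^ 5) * z ^ 6 * y ^ 1 - C (695 / 486 * p ^ 3) * z ^ 2 * y ^ 1
          - C (5242880 / 59049 * p ^ 9) * z ^ 13 * y ^ 0
          - C (7577600 / 177147 * p ^ 7) * z ^ 9 * y ^ 0 - C (2512 / 729 * p ^ 5) * z ^ 5 * y ^ 0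
          - C (10 / 81 * p ^ 3) * z ^ 1 * y ^ 0 := by
      simp only [g₂, C_1]
      ring
    rw [h]
    repeat' with_reducible first
      | refine totalDegree_sub_le_of_le ?_ ?_
      | refine totalDegree_add_le_of_le ?_ ?_
      | exact totalDegree_term_le _ (by norm_num)
  · refine le_trans ?_ (natDegree_restrict_le _)
    apply Polynomial.le_natDegree_of_ne_zero
    simp only [g₂, z, y, map_add, map_sub, map_mul (aeval _), map_pow (aeval _), aeval_C, aeval_X,
      Matrix.cons_val_zero, Matrix.cons_val_one, Polynomial.algebraMap_apply, Algebra.algebraMap_self,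
      RingHom.id_apply, ne_eq, OfNat.ofNat_ne_zero, not_false_eq_true, zero_pow, mul_zero, zero_mul,
      add_zero, zero_add, sub_zero, Polynomial.coeff_add, Polynomial.coeff_sub,
      Polynomial.coeff_C_mul, Polynomial.coeff_X_pow, Polynomial.coeff_X]
    simp [hp]

theorem exists_curveGenus_g₂_eq_two {p : ℂ} (hp : p ≠ 0) :
    ∃ h : Irreducible (g₂ p), curveGenus (g₂ p) h = 2 := by
  obtain ⟨ρ, hρ⟩ := IsAlgClosed.exists_pow_nat_eq (p / 3) (n := 2) (by norm_num)
  have hρ0 : ρ ≠ 0 := by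
    rintro rfl
    exact hp (by linear_combination (-3) * hρ)
  have hp' : p = 3 * ρ ^ 2 := by rw [hρ]; ring
  obtain ⟨S, hS, h0S, hpt⟩ := exists_points₂
  have hscale : scale 1 (Units.mk0 ρ hρ0) (g₂ p) =
      C (ρ ^ 5) * scale (Units.mk0 ρ hρ0) 1 (g₂ 3) := by
    rw [hp']
    simp only [g₂, map_add, map_sub, map_mul (scale _ _), map_pow (scale _ _), scale_z, scale_y,
      scale_C]
    refine MvPolynomial.funext fun v => ?_
    simp only [map_add, map_sub, map_mul (eval v), map_pow (eval v), eval_C, Units.val_mk0,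
      Units.val_one]
    ring
  refine exists_curveGenus_eq_two _ (associated_scale hρ0 hscale) monic_toBivariate₂.1
    monic_toBivariate₂.2 separable_f₂ ?_ separable_f₂' ?_ ?_ ?_ aeval_parametrization₂
    aeval_inverse₂ ?_ hS h0S hpt
  · intro a b h
    refine eq_zero_of_sq_eq_of_X_mul (s := Polynomial.C (-15) * r₂) ?_ (h.trans ?_)
    · simp [r₂]
    · rw [f₂]; ring
  · intro a b h
    refine eq_zero_of_sq_eq_of_odd_natDegree ?_ h
    have : f₂'.natDegree = 5 := by
      rw [f₂']
      compute_degree!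
    rw [this]
    decide
  · intro K _ _ x hx
    simp only [f₂, f₂', r₂, map_mul, map_sub, map_add, map_neg, map_pow,
      Polynomial.aeval_X, map_ofNat, map_one]
    field_simp
    ring
  · intro h
    have := congrArg (Polynomial.eval 0) h
    simp [n₂] at this
  · simp [inverseDenom₂, z, y]

end QuadraticCurves

theorem mainTheorem3 :
    (∀ q : ℂ, q ≠ 0 →
      QuadraticCurves.IsInvariantWithCofactor QuadraticCurves.P (QuadraticCurves.Q₁ q)
        (QuadraticCurves.g₁ q) (15 * QuadraticCurves.y) ∧
      (QuadraticCurves.g₁ q).totalDegree = 15 ∧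
      ∃ h : Irreducible (QuadraticCurves.g₁ q),
        QuadraticCurves.curveGenus (QuadraticCurves.g₁ q) h = 2) ∧
    (∀ p : ℂ, p ≠ 0 →
      QuadraticCurves.IsInvariantWithCofactor QuadraticCurves.P (QuadraticCurves.Q₂ p)
        (QuadraticCurves.g₂ p) (15 * QuadraticCurves.y) ∧
      (QuadraticCurves.g₂ p).totalDegree = 15 ∧
      ∃ h : Irreducible (QuadraticCurves.g₂ p),
        QuadraticCurves.curveGenus (QuadraticCurves.g₂ p) h = 2) := by
  refine ⟨fun q hq => ⟨?_, ?_, ?_⟩, fun p hp => ⟨?_, ?_, ?_⟩⟩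
  · exact QuadraticCurves.isInvariantWithCofactor₁ q
  · exact QuadraticCurves.totalDegree_g₁ hq
  · exact QuadraticCurves.exists_curveGenus_g₁_eq_two hq
  · exact QuadraticCurves.isInvariantWithCofactor₂ p
  · exact QuadraticCurves.totalDegree_g₂ hp
  · exact QuadraticCurves.exists_curveGenus_g₂_eq_two hp
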